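/- **Theorem (sample complexity of the last-window average strategy of RMDO).** *Setting.* Let $G$ be a finite two-player zero-sum extensive-form game with chance moves and perfect recall, in which any two payoffs of a player differ by at most $\Delta$. Let $|A|$ be the largest number of actions available at an information set of $G$. Let $m:\mathbb N\to\{1,2,\dots\}$ (the frequency function) and let $\varepsilon>0$. A profile $\pi=(\pi_1,\pi_2)$ of behaviour strategies is an $\varepsilon$-Nash equilibrium if, for both players $i$, $\min_{\pi'_{-i}}v_i(\pi_i,\pi'_{-i})+\varepsilon\ge v_i(\pi)\ge\max_{\pi'_i}v_i(\pi'_i,\pi_{-i})-\varepsilon$, where $v_i$ is the expected payoff. *RMDO.* A population $\Pi$ gives each player a nonempty set of allowed actions at each of that player's information sets; the restricted game $G|_\Pi$ is $G$ with only these actions. The first population consists of the actions of pure best responses of both players to the uniformly random strategies; put $j=0$. In iteration $t=1,2,\dots$: 1. one iteration of vanilla CFR (counterfactual regrets updated for both players simultaneously, strategies by regret matching, uniform when no regret is positive) is run in the current restricted game; 2. if $m(j)$ divides $t$, let $\tilde\pi^t$ be the average of the strategies of all iterations of the current window up to and including $t$, and add to the population, at every information set of $G$, the actions of pure best responses, in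 $G$, of both players to $\tilde\pi^t$. If this changes the population, a new time window starts: $j$ increases by $1$ and the regrets and strategies of CFR are reset. Ties between best responses are broken arbitrarily. The average $\tilde\pi^t$, called the *last-window average strategy*, is defined for every $t\ge1$. It is the usual average of CFR: the probabilities at an information set are weighted with the player's own contribution to the probability of reaching it. As a strategy of $G$ it gives probability $0$ to actions outside the population, and it is uniform on the allowed actions at information sets that do not occur in the restricted game. *Sample count.* One iteration of CFR costs the number of information sets (of both players) of the current restricted game, and so does one computation of best responses of both players. The best responses to the uniform strategies are charged as many samples as the first restricted game has information sets. *Claim.* There is an absolute constant $C>0$ such that, for all $G,\Delta,m,\varepsilon$ as above and all tie-breaking, there is a first iteration $T\ge1$ at which the last-window average strategy $\tilde\pi^T$ is an $\varepsilon$-Nash equilibrium of $G$, and the number of samples used up to the end of iteration $T$ is at most $$C\left(\frac{\Delta^2\,k\,|A|\,X^3}{\varepsilon^2}+\sum_{j=0}^{k-1}\left(\frac{\Delta^2\,|A|\,X^3}{\varepsilon^2\,m(j)}+X\,m(j)\right)\right),$$ where $k$ is the number of time windows (restricted games) up to iteration $T$ and $X$ is the number of information sets of both players in the restricted game of iteration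 $T$. The same holds when $T$ is instead the first iteration at which best responses are computed and $\tilde\pi^T$ is an $\varepsilon$-Nash equilibrium of $G$, with $k$ and $X$ taken at that iteration. In particular, for bounded $\Delta$ the sample complexity is $\tilde O\big(k|A|X^3/\varepsilon^2+\sum_j(|A|X^3/(\varepsilon^2m(j))+Xm(j))\big)$. -/

import Mathlib

/- Two-player zero-sum extensive-form games, counterfactual regret minimization (CFR) and the
   Regret-Minimizing Double Oracle (RMDO) algorithm. -/

open scoped Classical
open Finset

universe u v

/-- The two players. -/
abbrev Player := Fin 2

/-- What happens at a history: the game is over, chance moves, or a player moves. -/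
inductive Turn where
  | terminal : Turn
  | chance : Turn
  | player (i : Player) : Turn

/-- A finite two-player zero-sum extensive-form game. A history is the list of the actions taken so
far, the most recent one first, so that the history `h` followed by `a` is `a :: h`.
Player `i` acting at `h` only sees the label `info h`: the information sets of player `i` are
the sets of histories of player `i` with a common label, and the actions available at a decision
history depend only on the player and the label. `payoff z` is the payoff to player `0`. -/
structure EFG (A : Type u) (I : Type v) where
  hist : Finset (List A)
  turn : List A → Turn
  info : List A → I
  avail : Player → I → Finset A
  chanceActs : List A → Finset A
  chanceProb : List A → A → ℝ
  payoff : List A → ℝ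
  nil_mem : [] ∈ hist
  cons_mem : ∀ h a, a :: h ∈ hist ↔ h ∈ hist ∧ a ∈ (match turn h with
    | Turn.terminal => ∅
    | Turn.chance => chanceActs h
    | Turn.player i => avail i (info h))
  avail_nonempty : ∀ i s, (avail i s).Nonempty
  chanceProb_nonneg : ∀ h ∈ hist, turn h = Turn.chance → ∀ a ∈ chanceActs h, 0 ≤ chanceProb h a
  chanceProb_sum : ∀ h ∈ hist, turn h = Turn.chance → ∑ a ∈ chanceActs h, chanceProb h a = 1

/-- A profile of behaviour strategies: `σ i s a` is the probability with which player `i` takes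
action `a` at the information set `s`. -/
abbrev Profile (A : Type u) (I : Type v) := Player → I → A → ℝ

noncomputable section

namespace EFG

variable {A : Type u} {I : Type v}

/-- The terminal histories. -/
def terminals (G : EFG A I) : Finset (List A) := G.hist.filter fun h => G.turn h = Turn.terminal

/-- The histories in the information set `s` of player `i`. -/
def infoset (G : EFG A I) (i : Player) (s : I) : Finset (List A) :=
  G.hist.filter fun h => G.turn h = Turn.player i ∧ G.info h = s

/-- The information sets at which player `i` has to move. -/
def infosets (G : EFG A I) (i : Player) : Finset I :=
  (G.hist.filter fun h => G.turn h = Turn.player i).image G.info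

/-- The number of information sets of both players together. -/
def size (G : EFG A I) : ℕ := ∑ i : Player, (G.infosets i).card

/-- The largest number of actions available at an information set. -/
def maxActs (G : EFG A I) : ℕ :=
  (univ : Finset Player).sup fun i => (G.infosets i).sup fun s => (G.avail i s).card

/-- The information sets visited and the actions taken by player `i` along a history. -/
def ownSeq (G : EFG A I) (i : Player) : List A → List (I × A)
  | [] => []
  | a :: h => if G.turn h = Turn.player i then (G.info h, a) :: ownSeq G i h else ownSeq G i h

/-- Perfect recall: histories that a player cannot tell apart agree on what that player has
seen and done before. -/
def PerfectRecall (G : EFG A I) : Prop :=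
  ∀ i s, ∀ h ∈ G.infoset i s, ∀ g ∈ G.infoset i s, G.ownSeq i h = G.ownSeq i g

/-- The payoff to player `i` at a terminal history (zero-sum). -/
def util (G : EFG A I) (i : Player) (z : List A) : ℝ := if i = 0 then G.payoff z else -G.payoff z

/-- `ρ` is a behaviour strategy of player `i`. -/
def IsStrategyOf (G : EFG A I) (i : Player) (ρ : I → A → ℝ) : Prop :=
  ∀ s ∈ G.infosets i, (∀ a, 0 ≤ ρ s a) ∧ (∀ a, a ∉ G.avail i s → ρ s a = 0) ∧
    ∑ a ∈ G.avail i s, ρ s a = 1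

/-- Both components of `σ` are behaviour strategies. -/
def IsProfile (G : EFG A I) (σ : Profile A I) : Prop := ∀ i, G.IsStrategyOf i (σ i)

/-- The probability of taking action `a` at the history `h`. -/
def stepProb (G : EFG A I) (σ : Profile A I) (h : List A) (a : A) : ℝ :=
  match G.turn h with
  | Turn.terminal => 0
  | Turn.chance => G.chanceProb h a
  | Turn.player i => σ i (G.info h) a

/-- The probability of reaching a history from the root. -/
def reach (G : EFG A I) (σ : Profile A I) : List A → ℝ
  | [] => 1
  | a :: h => reach G σ h * G.stepProb σ h a

/-- The contribution of player `i` to the probability of reaching a history. -/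
def ownReach (G : EFG A I) (σ : Profile A I) (i : Player) : List A → ℝ
  | [] => 1
  | a :: h => ownReach G σ i h * if G.turn h = Turn.player i then σ i (G.info h) a else 1

/-- The contribution of chance and of the opponent of player `i` to the probability of reaching a
history. -/
def oppReach (G : EFG A I) (σ : Profile A I) (i : Player) : List A → ℝ
  | [] => 1
  | a :: h => oppReach G σ i h * if G.turn h = Turn.player i then 1 else G.stepProb σ h a

/-- `contProb G σ h z` is the probability of reaching `z` when play starts at `h`; it is `0` when
`z` does not extend `h`, and it is `reach z / reach h` when `z` extends `h` and `reach h > 0`. -/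
def contProb (G : EFG A I) (σ : Profile A I) (h : List A) : List A → ℝ
  | [] => if h = [] then 1 else 0
  | a :: z => if h = a :: z then 1 else contProb G σ h z * G.stepProb σ z a

/-- The expected payoff of player `i` when play starts at the history `h`. -/
def histValue (G : EFG A I) (σ : Profile A I) (i : Player) (h : List A) : ℝ :=
  ∑ z ∈ G.terminals, G.contProb σ h z * G.util i z

/-- The expected payoff of player `i` in the game. -/
def value (G : EFG A I) (σ : Profile A I) (i : Player) : ℝ :=
  ∑ z ∈ G.terminals, G.reach σ z * G.util i z

/-- `σ` is an `ε`-Nash equilibrium: no change of the opponent's strategy lowers the payoff of a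
player by more than `ε`, and no change of one's own strategy raises it by more than `ε`.
(In `Fin 2`, the opponent of `i` is `1 - i`.) -/
def IsEpsNash (G : EFG A I) (ε : ℝ) (σ : Profile A I) : Prop :=
  G.IsProfile σ ∧ ∀ i,
    (∀ ρ, G.IsStrategyOf (1 - i) ρ →
      G.value σ i ≤ G.value (Function.update σ (1 - i) ρ) i + ε) ∧
    (∀ ρ, G.IsStrategyOf i ρ → G.value (Function.update σ i ρ) i - ε ≤ G.value σ i)

/-- A pure strategy for each player: one available action at every information set. -/
abbrev PureProfile (G : EFG A I) := (i : Player) → (s : I) → {a : A // a ∈ G.avail i s}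

/-- A pure strategy of player `i`, as a behaviour strategy. -/
def pureStrategy {G : EFG A I} (p : G.PureProfile) (i : Player) : I → A → ℝ :=
  fun s a => if a = (p i s : A) then 1 else 0

/-- The pure strategy `p i` is a best response of player `i` to the opponent's strategy in `σ`. -/
def IsBestResponse (G : EFG A I) (σ : Profile A I) (p : G.PureProfile) (i : Player) : Prop :=
  ∀ ρ, G.IsStrategyOf i ρ →
    G.value (Function.update σ i ρ) i ≤ G.value (Function.update σ i (pureStrategy p i)) i

/-- The uniformly random strategies. -/
def uniform (G : EFG A I) : Profile A I :=
  fun i s a => if a ∈ G.avail i s then 1 / ((G.avail i s).card : ℝ) else 0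

/-! ### Counterfactual regret minimization -/

/-- The instantaneous counterfactual regret of player `i` for action `a` at the information set
`s`. -/
def instRegret (G : EFG A I) (σ : Profile A I) (i : Player) (s : I) (a : A) : ℝ :=
  ∑ h ∈ G.infoset i s, G.oppReach σ i h * (G.histValue σ i (a :: h) - G.histValue σ i h)

/-- Regret matching: play proportionally to the positive parts of the regrets `R`, and uniformly
if none is positive. -/
def regretMatching (G : EFG A I) (R : Player → I → A → ℝ) : Profile A I :=
  fun i s a =>
    if 0 < ∑ b ∈ G.avail i s, max 0 (R i s b) then
      if a ∈ G.avail i s then max 0 (R i s a) / ∑ b ∈ G.avail i s, max 0 (R i s b) else 0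
    else G.uniform i s a

/-- The counterfactual regrets accumulated in the first `n` iterations of CFR. (Dividing them by
`n` would not change the strategies.) -/
def cfrRegret (G : EFG A I) : ℕ → Player → I → A → ℝ
  | 0 => fun _ _ _ => 0
  | n + 1 => fun i s a =>
      cfrRegret G n i s a + G.instRegret (G.regretMatching (cfrRegret G n)) i s a

/-- The strategies played in iteration `n + 1` of CFR; those of the first iteration are uniform. -/
def cfrStrategy (G : EFG A I) (n : ℕ) : Profile A I := G.regretMatching (G.cfrRegret n)

/-- The weight of an information set in the averaging of strategies. Under perfect recall, the
contribution of player `i` to reaching a history is the same for all histories in an information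
set, and the weight is this common value times the number of histories. -/
def infoWeight (G : EFG A I) (σ : Profile A I) (i : Player) (s : I) : ℝ :=
  ∑ h ∈ G.infoset i s, G.ownReach σ i h

/-- The average strategies of the first `n` iterations of CFR. Strategies are averaged as
mixed strategies, which means that the probabilities at an information set are weighted with the
player's own contribution to reaching it. Where these weights vanish, the strategy is uniform. -/
def cfrAverage (G : EFG A I) (n : ℕ) : Profile A I :=
  fun i s a =>
    if 0 < ∑ t ∈ range n, G.infoWeight (G.cfrStrategy t) i s then
      (∑ t ∈ range n, G.infoWeight (G.cfrStrategy t) i s * G.cfrStrategy t i s a) /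
        ∑ t ∈ range n, G.infoWeight (G.cfrStrategy t) i s
    else G.uniform i s a

/-! ### Restricted games -/

/-- A population: the actions that each player may use at each information set. -/
@[ext] structure Population (G : EFG A I) where
  acts : Player → I → Finset A
  subset : ∀ i s, acts i s ⊆ G.avail i s
  nonempty : ∀ i s, (acts i s).Nonempty

/-- The population with a single pure strategy for each player. -/
def Population.ofPure {G : EFG A I} (p : G.PureProfile) : G.Population where
  acts := fun i s => {(p i s : A)}
  subset := fun i s => singleton_subset_iff.2 (p i s).2
  nonempty := fun i s => by simp

/-- Adds to the population, at every information set of the game, the action of the pure strategy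
`p`. -/
def Population.add {G : EFG A I} (B : G.Population) (p : G.PureProfile) : G.Population where
  acts := fun i s => if s ∈ G.infosets i then insert (p i s : A) (B.acts i s) else B.acts i s
  subset := fun i s => by
    split_ifs
    · exact insert_subset (p i s).2 (B.subset i s)
    · exact B.subset i s
  nonempty := fun i s => by
    split_ifs
    · exact insert_nonempty _ _
    · exact B.nonempty i s

/-- The histories along which both players only take actions from the population. -/
def Population.Allows {G : EFG A I} (B : G.Population) : List A → Prop
  | [] => True
  | a :: h => Population.Allows B h ∧ ∀ i, G.turn h = Turn.player i → a ∈ B.acts i (G.info h)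

/-- The restricted game, in which the players only have the actions in the population. -/
def restrict (G : EFG A I) (B : G.Population) : EFG A I where
  hist := G.hist.filter B.Allows
  turn := G.turn
  info := G.info
  avail := B.acts
  chanceActs := G.chanceActs
  chanceProb := G.chanceProb
  payoff := G.payoff
  nil_mem := by simp [G.nil_mem, Population.Allows]
  cons_mem := by
    intro h a
    have hsub := B.subset
    simp only [mem_filter, G.cons_mem, Population.Allows]
    cases ht : G.turn h with
    | terminal => simp
    | chance => simp; tauto
    | player i =>
      simp only [Turn.player.injEq, forall_eq']
      constructor
      · tauto
      · rintro ⟨⟨h1, h2⟩, h3⟩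
        exact ⟨⟨h1, hsub i _ h3⟩, h2, h3⟩
  avail_nonempty := B.nonempty
  chanceProb_nonneg := fun h hh => G.chanceProb_nonneg h (mem_filter.1 hh).1
  chanceProb_sum := fun h hh => G.chanceProb_sum h (mem_filter.1 hh).1

/-! ### Regret-Minimizing Double Oracle -/

/-- The state of RMDO at the start of an iteration: the index of the current time window, the
current population, and the number of iterations completed in the current window. -/
structure State (G : EFG A I) where
  win : ℕ
  pop : G.Population
  len : ℕ

/-- A best response oracle: it returns a pure best response of each player to the opponent's
strategy. The iteration is an argument too, so that ties may be broken in any way. -/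
def IsOracle (G : EFG A I) (br : ℕ → Profile A I → G.PureProfile) : Prop :=
  ∀ t σ, G.IsProfile σ → ∀ i, G.IsBestResponse σ (br t σ) i

/-- The restricted game of a state. -/
def State.game {G : EFG A I} (S : G.State) : EFG A I := G.restrict S.pop

/-- The average strategies of the current window, including the iteration that starts in the state
`S`. They are strategies of the whole game, with probability zero outside of the population. -/
def State.las {G : EFG A I} (S : G.State) : Profile A I := S.game.cfrAverage (S.len + 1)

/-- Iteration `t` of RMDO, started in the state `S`: one iteration of CFR in the restricted game,
then, if `m(j)` divides `t`, best responses to the average strategies of the window are added to the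
population; if the population grows, a new window starts and CFR is reset. -/
def step (G : EFG A I) (m : ℕ → ℕ) (br : ℕ → Profile A I → G.PureProfile) (t : ℕ)
    (S : G.State) : G.State :=
  if t % m S.win = 0 ∧ S.pop.add (br t S.las) ≠ S.pop then
    { win := S.win + 1, pop := S.pop.add (br t S.las), len := 0 }
  else { S with len := S.len + 1 }

/-- The state of RMDO at the start of iteration `t`, for `t ≥ 1`. The first population consists of
best responses to the uniformly random strategies. (The value at `0` plays no role.) -/
def rmdo (G : EFG A I) (m : ℕ → ℕ) (br : ℕ → Profile A I → G.PureProfile) : ℕ → G.State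
  | 0 => { win := 0, pop := Population.ofPure (br 0 G.uniform), len := 0 }
  | 1 => { win := 0, pop := Population.ofPure (br 0 G.uniform), len := 0 }
  | t + 2 => G.step m br (t + 1) (rmdo G m br (t + 1))

/-- The last-window average strategies after iteration `t`. -/
def las (G : EFG A I) (m : ℕ → ℕ) (br : ℕ → Profile A I → G.PureProfile) (t : ℕ) : Profile A I :=
  (G.rmdo m br t).las

/-- Best responses are computed in iteration `t`. -/
def ComputesBR (G : EFG A I) (m : ℕ → ℕ) (br : ℕ → Profile A I → G.PureProfile) (t : ℕ) : Prop :=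
  t % m (G.rmdo m br t).win = 0

/-- The number of time windows up to iteration `t`. -/
def numWindows (G : EFG A I) (m : ℕ → ℕ) (br : ℕ → Profile A I → G.PureProfile) (t : ℕ) : ℕ :=
  (G.rmdo m br t).win + 1

/-- The number of information sets in the restricted game of iteration `t`. -/
def windowSize (G : EFG A I) (m : ℕ → ℕ) (br : ℕ → Profile A I → G.PureProfile) (t : ℕ) : ℕ :=
  (G.rmdo m br t).game.size

/-- The number of samples used by RMDO up to the end of iteration `t`. Each iteration of CFR and
each computation of best responses costs the number of information sets in the current
restricted game; the first summand is for the best responses to the uniform strategies. -/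
def samples (G : EFG A I) (m : ℕ → ℕ) (br : ℕ → Profile A I → G.PureProfile) (t : ℕ) : ℕ :=
  G.windowSize m br 1 +
    ∑ r ∈ Icc 1 t, (G.windowSize m br r + if G.ComputesBR m br r then G.windowSize m br r else 0)

/-- The bound for `k` time windows, at most `a` actions per information set, `X` information
sets in the last restricted game, payoff range `Δ` and precision `ε`. -/
def rmdoBound (m : ℕ → ℕ) (Δ ε : ℝ) (k a X : ℕ) : ℝ :=
  Δ ^ 2 * k * a * X ^ 3 / ε ^ 2 +
    ∑ j ∈ range k, (Δ ^ 2 * a * X ^ 3 / (ε ^ 2 * m j) + X * m j)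

end EFG

end

/-!
The last-window average strategies of RMDO are close to an equilibrium after few samples because
every time window is short, and it is short because CFR converges fast in the restricted game.

*CFR.* The gain of a player who deviates from `σ` to `ρ` telescopes along the game tree
(`value_update_sub`). Under perfect recall it becomes a sum over the information sets of the player,
of the counterfactual regrets averaged with `ρ` and multiplied with a factor in `[0, 1]` that
depends only on `ρ` (`value_update_sub_eq_sum_instRegret`). A counterfactual regret is at most `Δ`,
because the counterfactual reach probabilities of an information set add up to at most `1`
(`sum_oppReach_infoset_le_one`); so regret matching keeps the regrets accumulated in `n` iterations
below `Δ * √(n * maxActs)` (`sum_sq_cfrRegret_le`). The average strategies are realization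
equivalent to the mixture of the strategies played (`sum_ownReach_cfrStrategy`), and in a zero-sum
game the values of the strategies played cancel when the regrets of the two players are added.
Hence, after `D = Δ² * maxActs * size² / ε²` iterations, best responses to the average
strategies gain at most `ε` in total (`sum_value_update_cfrAverage_le_of_le`).

*Windows.* If best responses in the whole game do not change the population, they are strategies of
the restricted game, and the average strategies are an `ε`-equilibrium of the whole game as soon as
`D` iterations have been made (`State.isEpsNash_las`). So, before an equilibrium is found at a
computation of best responses, a window with frequency `m j` ends at the first such computation
after `D` iterations at the latest: it has at most `D + m j` iterations and at most `D / m j + 2`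
computations of best responses (`iterations_and_numBR_le`). Populations only grow, so that the size
of the last restricted game bounds the cost of each iteration, and the bound follows by summing over
the windows (`samples_le_rmdoBound`). As populations cannot grow forever, the algorithm does reach
an equilibrium (`exists_computesBR_isEpsNash`).
-/

namespace EFG

variable {A : Type u} {I : Type v}

/-! ### The game tree -/

/-- The actions that can be taken at a history, by whoever moves there. -/
def legal (G : EFG A I) (h : List A) : Finset A :=
  match G.turn h with
  | Turn.terminal => ∅
  | Turn.chance => G.chanceActs h
  | Turn.player i => G.avail i (G.info h)

theorem cons_mem_hist (G : EFG A I) {h : List A} {a : A} :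
    a :: h ∈ G.hist ↔ h ∈ G.hist ∧ a ∈ G.legal h := G.cons_mem h a

theorem legal_terminal (G : EFG A I) {h : List A} (ht : G.turn h = Turn.terminal) :
    G.legal h = ∅ := by simp [legal, ht]

theorem legal_chance (G : EFG A I) {h : List A} (ht : G.turn h = Turn.chance) :
    G.legal h = G.chanceActs h := by simp [legal, ht]

theorem legal_player (G : EFG A I) {h : List A} {i : Player} (ht : G.turn h = Turn.player i) :
    G.legal h = G.avail i (G.info h) := by simp [legal, ht]

theorem mem_infoset (G : EFG A I) {i : Player} {s : I} {h : List A} :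
    h ∈ G.infoset i s ↔ h ∈ G.hist ∧ G.turn h = Turn.player i ∧ G.info h = s := by
  simp [infoset]

theorem mem_terminals (G : EFG A I) {z : List A} :
    z ∈ G.terminals ↔ z ∈ G.hist ∧ G.turn z = Turn.terminal := by
  simp [terminals]

theorem info_mem_infosets (G : EFG A I) {i : Player} {h : List A} (hh : h ∈ G.hist)
    (ht : G.turn h = Turn.player i) : G.info h ∈ G.infosets i :=
  mem_image_of_mem _ (mem_filter.2 ⟨hh, ht⟩)

/-- Backward induction on the finite game tree. -/
theorem hist_induction (G : EFG A I) {P : List A → Prop}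
    (H : ∀ h ∈ G.hist, (∀ a ∈ G.legal h, P (a :: h)) → P h) : ∀ h ∈ G.hist, P h := by
  have key : ∀ n : ℕ, ∀ h ∈ G.hist, G.hist.sup List.length < n + h.length → P h := by
    intro n
    induction n with
    | zero =>
      intro h hh hn
      have := Finset.le_sup (f := List.length) hh
      omega
    | succ n ih =>
      intro h hh hn
      refine H h hh fun a ha => ih _ (G.cons_mem_hist.2 ⟨hh, ha⟩) ?_
      simp only [List.length_cons]
      omega
  exact fun h hh => key (G.hist.sup List.length + 1) h hh (by omega)

/-- Every history but the root is the child of exactly one history. -/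
theorem sum_children (G : EFG A I) (F : List A → ℝ) :
    ∑ h ∈ G.hist, ∑ a ∈ G.legal h, F (a :: h) = ∑ h ∈ G.hist, F h - F [] := by
  rw [← Finset.sum_erase_eq_sub G.nil_mem, Finset.sum_sigma']
  refine Finset.sum_bij (fun p _ => p.2 :: p.1) ?_ ?_ ?_ ?_
  · rintro ⟨h, a⟩ hp
    rw [mem_sigma] at hp
    exact mem_erase.2 ⟨by simp, G.cons_mem_hist.2 hp⟩
  · rintro ⟨h, a⟩ _ ⟨g, b⟩ _ he
    simp only [List.cons.injEq] at he
    obtain ⟨rfl, rfl⟩ := he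
    rfl
  · intro g hg
    rw [mem_erase] at hg
    cases g with
    | nil => exact absurd rfl hg.1
    | cons a h => exact ⟨⟨h, a⟩, mem_sigma.2 (G.cons_mem_hist.1 hg.2), rfl⟩
  · intros; rfl

/-! ### Reach probabilities -/

theorem stepProb_nonneg (G : EFG A I) {σ : Profile A I} (hσ : G.IsProfile σ) {h : List A}
    (hh : h ∈ G.hist) {a : A} (ha : a ∈ G.legal h) : 0 ≤ G.stepProb σ h a := by
  unfold stepProb
  cases ht : G.turn h with
  | terminal => simp
  | chance => exact G.chanceProb_nonneg h hh ht a (G.legal_chance ht ▸ ha)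
  | player i => exact (hσ i _ (G.info_mem_infosets hh ht)).1 a

theorem sum_stepProb (G : EFG A I) {σ : Profile A I} (hσ : G.IsProfile σ) {h : List A}
    (hh : h ∈ G.hist) (hn : G.turn h ≠ Turn.terminal) :
    ∑ a ∈ G.legal h, G.stepProb σ h a = 1 := by
  unfold stepProb
  cases ht : G.turn h with
  | terminal => exact absurd ht hn
  | chance => rw [G.legal_chance ht]; exact G.chanceProb_sum h hh ht
  | player i => rw [G.legal_player ht]; exact (hσ i _ (G.info_mem_infosets hh ht)).2.2

theorem stepProb_player (G : EFG A I) (σ : Profile A I) {h : List A} {i : Player}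
    (ht : G.turn h = Turn.player i) (a : A) : G.stepProb σ h a = σ i (G.info h) a := by
  simp [stepProb, ht]

theorem stepProb_update (G : EFG A I) (σ : Profile A I) {i : Player} (ρ : I → A → ℝ)
    {h : List A} (ht : G.turn h ≠ Turn.player i) (a : A) :
    G.stepProb (Function.update σ i ρ) h a = G.stepProb σ h a := by
  unfold stepProb
  cases hj : G.turn h with
  | terminal => rfl
  | chance => rfl
  | player j =>
    have : j ≠ i := fun e => ht (by rw [hj, e])
    simp [this]

/-- The contribution of chance to the probability of reaching a history. -/
def chanceReach (G : EFG A I) : List A → ℝ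
  | [] => 1
  | a :: h => chanceReach G h *
      match G.turn h with
      | Turn.terminal => 0
      | Turn.chance => G.chanceProb h a
      | Turn.player _ => 1

theorem reach_eq_ownReach_mul_oppReach (G : EFG A I) (σ : Profile A I) (i : Player) (h : List A) :
    G.reach σ h = G.ownReach σ i h * G.oppReach σ i h := by
  induction h with
  | nil => simp [reach, ownReach, oppReach]
  | cons a h ih =>
    simp only [reach, ownReach, oppReach, ih]
    split_ifs with ht
    · rw [G.stepProb_player σ ht]; ring
    · ring

theorem eq_opponent_of_ne {i j : Player} (h : j ≠ i) : j = 1 - i := by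
  revert i j; decide

theorem opponent_ne (i : Player) : 1 - i ≠ i := by
  revert i; decide

theorem oppReach_eq_chanceReach_mul_ownReach (G : EFG A I) (σ : Profile A I) (i : Player)
    (h : List A) : G.oppReach σ i h = G.chanceReach h * G.ownReach σ (1 - i) h := by
  induction h with
  | nil => simp [chanceReach, ownReach, oppReach]
  | cons a h ih =>
    simp only [oppReach, chanceReach, ownReach, ih, stepProb]
    cases ht : G.turn h with
    | terminal => simp
    | chance => simp; ring
    | player j =>
      by_cases hj : j = i
      · subst hj
        simp [(opponent_ne j).symm]
      · obtain rfl := eq_opponent_of_ne hj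
        simp [hj]; ring

/-- A player's contribution to reaching a history depends only on what that player has seen and
done, so that under perfect recall it is constant on information sets. -/
theorem ownReach_eq_prod (G : EFG A I) (σ : Profile A I) (i : Player) (h : List A) :
    G.ownReach σ i h = ((G.ownSeq i h).map fun p => σ i p.1 p.2).prod := by
  induction h with
  | nil => simp [ownReach, ownSeq]
  | cons a h ih =>
    simp only [ownReach, ownSeq]
    split_ifs <;> simp [ih, mul_comm]

theorem ownReach_congr (G : EFG A I) {σ τ : Profile A I} {i : Player} (e : σ i = τ i)
    (h : List A) : G.ownReach σ i h = G.ownReach τ i h := by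
  rw [ownReach_eq_prod, ownReach_eq_prod, e]

theorem oppReach_update (G : EFG A I) (σ : Profile A I) (i : Player) (ρ : I → A → ℝ)
    (h : List A) : G.oppReach (Function.update σ i ρ) i h = G.oppReach σ i h := by
  rw [oppReach_eq_chanceReach_mul_ownReach, oppReach_eq_chanceReach_mul_ownReach,
    G.ownReach_congr (by rw [Function.update_of_ne (opponent_ne i)])]

theorem ownReach_mem_Icc (G : EFG A I) {σ : Profile A I} {i : Player}
    (hσ : G.IsStrategyOf i (σ i)) : ∀ h ∈ G.hist, G.ownReach σ i h ∈ Set.Icc (0 : ℝ) 1 := by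
  intro h
  induction h with
  | nil => intro _; simp [ownReach]
  | cons a h ih =>
    intro hh
    obtain ⟨hh, ha⟩ := G.cons_mem_hist.1 hh
    obtain ⟨h0, h1⟩ := ih hh
    simp only [ownReach]
    split_ifs with ht
    · obtain ⟨p0, -, p1⟩ := hσ _ (G.info_mem_infosets hh ht)
      have hle : σ i (G.info h) a ≤ 1 := by
        rw [← p1]
        exact Finset.single_le_sum (f := fun a => σ i (G.info h) a) (fun b _ => p0 b)
          (G.legal_player ht ▸ ha)
      exact ⟨mul_nonneg h0 (p0 a), mul_le_one₀ h1 (p0 a) hle⟩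
    · simpa using ⟨h0, h1⟩

theorem oppReach_nonneg (G : EFG A I) {σ : Profile A I} (hσ : G.IsProfile σ) (i : Player) :
    ∀ h ∈ G.hist, 0 ≤ G.oppReach σ i h := by
  intro h
  induction h with
  | nil => intro _; simp [oppReach]
  | cons a h ih =>
    intro hh
    obtain ⟨hh, ha⟩ := G.cons_mem_hist.1 hh
    refine mul_nonneg (ih hh) ?_
    split_ifs
    · exact zero_le_one
    · exact G.stepProb_nonneg hσ hh ha

/-! ### Continuation values -/

theorem contProb_self (G : EFG A I) (σ : Profile A I) (h : List A) : G.contProb σ h h = 1 := by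
  cases h <;> simp [contProb]

theorem contProb_eq_zero (G : EFG A I) (σ : Profile A I) {h : List A} :
    ∀ z, ¬ h <:+ z → G.contProb σ h z = 0 := by
  intro z
  induction z with
  | nil => intro hz; simp_all [contProb]
  | cons b z ih =>
    intro hz
    rw [List.suffix_cons_iff, not_or] at hz
    simp [contProb, hz.1, ih hz.2]

theorem contProb_nil (G : EFG A I) (σ : Profile A I) (z : List A) :
    G.contProb σ [] z = G.reach σ z := by
  induction z with
  | nil => simp [contProb, reach]
  | cons b z ih => simp [contProb, reach, ih]

/-- `contProb` is defined by its last step; this is the recursion on its first step. -/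
theorem contProb_eq_sum (G : EFG A I) (σ : Profile A I) (h : List A) :
    ∀ z ∈ G.hist, z ≠ h →
      G.contProb σ h z = ∑ a ∈ G.legal h, G.stepProb σ h a * G.contProb σ (a :: h) z := by
  intro z
  induction z with
  | nil =>
    intro _ hz
    simp [contProb, hz.symm]
  | cons b z ih =>
    intro hz hne
    obtain ⟨hz, hb⟩ := G.cons_mem_hist.1 hz
    simp only [contProb, hne.symm, if_false]
    by_cases e : z = h
    · subst e
      rw [contProb_self, one_mul, Finset.sum_eq_single_of_mem b hb]
      · simp
      · intro a _ hab
        rw [G.contProb_eq_zero σ z (h := a :: z)]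
        · simp [hab]
        · intro hs
          have := hs.length_le
          simp at this
    · rw [ih hz e, Finset.sum_mul]
      refine Finset.sum_congr rfl fun a _ => ?_
      have : ¬ (a :: h = b :: z) := fun he => e (List.cons.inj he).2.symm
      rw [if_neg this, mul_assoc]

theorem histValue_terminal (G : EFG A I) (σ : Profile A I) (i : Player) {h : List A}
    (hh : h ∈ G.hist) (ht : G.turn h = Turn.terminal) : G.histValue σ i h = G.util i h := by
  unfold histValue
  rw [Finset.sum_eq_single_of_mem h (G.mem_terminals.2 ⟨hh, ht⟩), contProb_self, one_mul]
  intro z hz hne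
  rw [G.contProb_eq_sum σ h z (mem_filter.1 hz).1 hne, G.legal_terminal ht]
  simp

theorem histValue_eq_sum (G : EFG A I) (σ : Profile A I) (i : Player) {h : List A}
    (ht : G.turn h ≠ Turn.terminal) :
    G.histValue σ i h = ∑ a ∈ G.legal h, G.stepProb σ h a * G.histValue σ i (a :: h) := by
  unfold histValue
  simp_rw [Finset.mul_sum]
  rw [Finset.sum_comm]
  refine Finset.sum_congr rfl fun z hz => ?_
  obtain ⟨hz, hzt⟩ := mem_filter.1 hz
  rw [G.contProb_eq_sum σ h z hz (fun e => ht (e ▸ hzt)), Finset.sum_mul]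
  exact Finset.sum_congr rfl fun a _ => by ring

theorem histValue_nil (G : EFG A I) (σ : Profile A I) (i : Player) :
    G.histValue σ i [] = G.value σ i := by
  simp [histValue, value, contProb_nil]

theorem histValue_le (G : EFG A I) {σ : Profile A I} (hσ : G.IsProfile σ) {i : Player} {c : ℝ}
    (hc : ∀ z ∈ G.terminals, G.util i z ≤ c) : ∀ h ∈ G.hist, G.histValue σ i h ≤ c := by
  refine G.hist_induction fun h hh ih => ?_
  by_cases ht : G.turn h = Turn.terminal
  · rw [G.histValue_terminal σ i hh ht]
    exact hc h (G.mem_terminals.2 ⟨hh, ht⟩)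
  · rw [G.histValue_eq_sum σ i ht, ← one_mul c, ← G.sum_stepProb hσ hh ht, Finset.sum_mul]
    exact Finset.sum_le_sum fun a ha =>
      mul_le_mul_of_nonneg_left (ih a ha) (G.stepProb_nonneg hσ hh ha)

theorem le_histValue (G : EFG A I) {σ : Profile A I} (hσ : G.IsProfile σ) {i : Player} {c : ℝ}
    (hc : ∀ z ∈ G.terminals, c ≤ G.util i z) : ∀ h ∈ G.hist, c ≤ G.histValue σ i h := by
  refine G.hist_induction fun h hh ih => ?_
  by_cases ht : G.turn h = Turn.terminal
  · rw [G.histValue_terminal σ i hh ht]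
    exact hc h (G.mem_terminals.2 ⟨hh, ht⟩)
  · rw [G.histValue_eq_sum σ i ht, ← one_mul c, ← G.sum_stepProb hσ hh ht, Finset.sum_mul]
    exact Finset.sum_le_sum fun a ha =>
      mul_le_mul_of_nonneg_left (ih a ha) (G.stepProb_nonneg hσ hh ha)

/-- Any two continuation values differ by at most the range of the payoffs. -/
theorem abs_histValue_sub_le (G : EFG A I) {σ : Profile A I} (hσ : G.IsProfile σ) (i : Player)
    {Δ : ℝ} (hΔ : ∀ z ∈ G.terminals, ∀ w ∈ G.terminals, G.payoff z - G.payoff w ≤ Δ)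
    {h g : List A} (hh : h ∈ G.hist) (hg : g ∈ G.hist) :
    |G.histValue σ i h - G.histValue σ i g| ≤ Δ := by
  have hu : ∀ z ∈ G.terminals, ∀ w ∈ G.terminals, G.util i z ≤ Δ + G.util i w := by
    intro z hz w hw
    have h1 := hΔ z hz w hw
    have h2 := hΔ w hw z hz
    unfold util
    split_ifs <;> linarith
  have key : ∀ h ∈ G.hist, ∀ g ∈ G.hist, G.histValue σ i h - Δ ≤ G.histValue σ i g := by
    intro h hh g hg
    refine G.le_histValue hσ (fun w hw => ?_) g hg
    have := G.histValue_le hσ (fun z hz => hu z hz w hw) h hh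
    linarith
  rw [abs_le]
  constructor <;> linarith [key h hh g hg, key g hg h hh]

/-! ### The value of a deviation -/

/-- If player `i` deviates to `ρ`, the gain is the sum, over all decision histories of the
player, of the probability of reaching the history with `ρ` times the gain from playing `ρ` at this
history only and `σ` afterwards. The reason is that `reach * histValue`, with `ρ` in the
first factor and `σ` in the second, telescopes along the tree. -/
theorem value_update_sub (G : EFG A I) {σ : Profile A I} {i : Player} {ρ : I → A → ℝ}
    (hρ : G.IsStrategyOf i ρ) :
    G.value (Function.update σ i ρ) i - G.value σ i =
      ∑ h ∈ G.hist with G.turn h = Turn.player i,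
        G.ownReach (Function.update σ i ρ) i h * (G.oppReach σ i h *
          ∑ a ∈ G.avail i (G.info h), ρ (G.info h) a *
            (G.histValue σ i (a :: h) - G.histValue σ i h)) := by
  set τ := Function.update σ i ρ with hτ
  have h1 := G.sum_children fun h => G.reach τ h * G.histValue σ i h
  have h2 : G.value τ i = ∑ h ∈ G.hist,
      if G.turn h = Turn.terminal then G.reach τ h * G.histValue σ i h else 0 := by
    rw [← Finset.sum_filter]
    refine Finset.sum_congr rfl fun z hz => ?_
    obtain ⟨hz, ht⟩ := mem_filter.1 hz
    rw [G.histValue_terminal σ i hz ht]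
  have h3 : G.value τ i - G.value σ i = ∑ h ∈ G.hist,
      ((if G.turn h = Turn.terminal then G.reach τ h * G.histValue σ i h else 0) +
        ∑ a ∈ G.legal h, G.reach τ (a :: h) * G.histValue σ i (a :: h) -
        G.reach τ h * G.histValue σ i h) := by
    rw [Finset.sum_sub_distrib, Finset.sum_add_distrib, ← h2, h1, histValue_nil, reach]
    ring
  rw [h3, Finset.sum_filter]
  refine Finset.sum_congr rfl fun h hh => ?_
  by_cases ht : G.turn h = Turn.terminal
  · simp [ht, G.legal_terminal ht]
  · rw [if_neg ht, zero_add]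
    split_ifs with hi
    · have hs := (hρ _ (G.info_mem_infosets hh hi)).2.2
      have hr : G.reach τ h = G.ownReach τ i h * G.oppReach σ i h := by
        rw [G.reach_eq_ownReach_mul_oppReach τ i h, hτ, G.oppReach_update]
      have hp : ∀ a, G.stepProb τ h a = ρ (G.info h) a := fun a => by
        rw [G.stepProb_player τ hi, hτ, Function.update_self]
      simp only [mul_sub, Finset.sum_sub_distrib, ← Finset.sum_mul, hs, G.legal_player hi, reach,
        hp, hr, Finset.mul_sum, one_mul, mul_assoc]
    · rw [G.histValue_eq_sum σ i ht, Finset.mul_sum, sub_eq_zero]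
      refine Finset.sum_congr rfl fun a _ => ?_
      rw [reach, hτ, G.stepProb_update σ ρ hi]
      ring

theorem infoWeight_eq (G : EFG A I) (hG : G.PerfectRecall) (σ : Profile A I) {i : Player} {s : I}
    {h : List A} (hh : h ∈ G.infoset i s) :
    G.infoWeight σ i s = (G.infoset i s).card * G.ownReach σ i h := by
  rw [infoWeight, ← nsmul_eq_mul]
  refine Finset.sum_eq_card_nsmul fun g hg => ?_
  rw [ownReach_eq_prod, ownReach_eq_prod, hG i s h hh g hg]

theorem sum_player_hist (G : EFG A I) (i : Player) (F : List A → ℝ) :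
    ∑ h ∈ G.hist with G.turn h = Turn.player i, F h =
      ∑ s ∈ G.infosets i, ∑ h ∈ G.infoset i s, F h := by
  rw [← Finset.sum_fiberwise_of_maps_to (t := G.infosets i) (g := G.info)
    (fun h hh => mem_image_of_mem _ hh)]
  refine Finset.sum_congr rfl fun s _ => Finset.sum_congr ?_ fun _ _ => rfl
  rw [infoset, Finset.filter_filter]

/-- Under perfect recall, the gain from a deviation is a combination of the counterfactual
regrets, with coefficients in `[0, 1]` that depend only on the deviation. -/
theorem value_update_sub_eq_sum_instRegret (G : EFG A I) (hG : G.PerfectRecall) {i : Player}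
    {ρ : I → A → ℝ} (hρ : G.IsStrategyOf i ρ) :
    ∃ w : I → ℝ, (∀ s ∈ G.infosets i, w s ∈ Set.Icc (0 : ℝ) 1) ∧ ∀ σ : Profile A I,
      G.value (Function.update σ i ρ) i - G.value σ i =
        ∑ s ∈ G.infosets i, w s * ∑ a ∈ G.avail i s, ρ s a * G.instRegret σ i s a := by
  have hc : ∀ s ∈ G.infosets i, ∃ c ∈ Set.Icc (0 : ℝ) 1, ∀ h ∈ G.infoset i s,
      G.ownReach (fun _ => ρ) i h = c := by
    intro s hs
    obtain ⟨h, hh, rfl⟩ := mem_image.1 hs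
    obtain ⟨hh, ht⟩ := mem_filter.1 hh
    refine ⟨_, G.ownReach_mem_Icc (σ := fun _ => ρ) hρ h hh, fun g hg => ?_⟩
    rw [ownReach_eq_prod, ownReach_eq_prod, hG i _ g hg h (G.mem_infoset.2 ⟨hh, ht, rfl⟩)]
  choose! w hw hw' using hc
  refine ⟨w, hw, fun σ => ?_⟩
  rw [G.value_update_sub hρ, sum_player_hist]
  refine Finset.sum_congr rfl fun s hs => ?_
  simp only [instRegret, Finset.mul_sum]
  symm
  rw [Finset.sum_comm]
  refine Finset.sum_congr rfl fun h hh => ?_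
  have hown : G.ownReach (Function.update σ i ρ) i h = w s := by
    rw [← hw' s hs h hh]
    exact G.ownReach_congr (by simp) h
  rw [hown, (G.mem_infoset.1 hh).2.2]
  exact Finset.sum_congr rfl fun a _ => by ring

/-! ### Zero-sum games -/

theorem util_opponent (G : EFG A I) (i : Player) (z : List A) :
    G.util (1 - i) z = - G.util i z := by
  fin_cases i <;> simp [util]

theorem value_opponent (G : EFG A I) (σ : Profile A I) (i : Player) :
    G.value σ (1 - i) = - G.value σ i := by
  simp [value, util_opponent]

/-! ### Counterfactual reach of an information set -/

theorem mem_hist_of_suffix (G : EFG A I) {h : List A} :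
    ∀ {g : List A}, h <:+ g → g ∈ G.hist → h ∈ G.hist := by
  intro g
  induction g with
  | nil => intro hs hg; rwa [List.suffix_nil.1 hs]
  | cons b g ih =>
    intro hs hg
    rcases List.suffix_cons_iff.1 hs with rfl | hs
    · exact hg
    · exact ih hs (G.cons_mem_hist.1 hg).1

theorem exists_cons_suffix {h g : List A} (hs : h <:+ g) (hne : h ≠ g) : ∃ a, a :: h <:+ g := by
  obtain ⟨l, rfl⟩ := hs
  rcases List.eq_nil_or_concat l with rfl | ⟨l, a, rfl⟩
  · simp at hne
  · exact ⟨a, l, by simp⟩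

/-- If a nonnegative function on the tree does not grow in passing from a history to its
children, its sum over pairwise incomparable extensions of a history is at most its value
there. -/
theorem sum_antichain_le (G : EFG A I) {F : List A → ℝ} (F0 : ∀ h ∈ G.hist, 0 ≤ F h)
    (hF : ∀ h ∈ G.hist, ∑ a ∈ G.legal h, F (a :: h) ≤ F h) {S : Finset (List A)}
    (hS : S ⊆ G.hist) (hanti : ∀ g ∈ S, ∀ g' ∈ S, g <:+ g' → g = g') :
    ∀ h ∈ G.hist, ∑ g ∈ S with h <:+ g, F g ≤ F h := by
  refine G.hist_induction fun h hh ih => ?_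
  by_cases hS' : h ∈ S
  · have : S.filter (h <:+ ·) = {h} := by
      ext g
      simp only [mem_filter, mem_singleton]
      exact ⟨fun hg => (hanti h hS' g hg.1 hg.2).symm, fun e => by
        rw [e]; exact ⟨hS', List.suffix_rfl⟩⟩
    simp [this]
  · refine le_trans ?_ ((Finset.sum_le_sum ih).trans (hF h hh))
    simp_rw [Finset.sum_filter]
    rw [Finset.sum_comm]
    refine Finset.sum_le_sum fun g hg => ?_
    have h0 : ∀ a ∈ G.legal h, 0 ≤ if a :: h <:+ g then F g else 0 := fun a _ => by
      split_ifs
      · exact F0 g (hS hg)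
      · exact le_rfl
    split_ifs with hs
    · obtain ⟨a, ha⟩ := exists_cons_suffix hs (fun e => hS' (e ▸ hg))
      have := Finset.single_le_sum h0
        (G.cons_mem_hist.1 (G.mem_hist_of_suffix ha (hS hg))).2
      simpa [ha] using this
    · exact Finset.sum_nonneg h0

theorem ownSeq_length_lt (G : EFG A I) {i : Player} {g : List A}
    (hg : G.turn g = Turn.player i) :
    ∀ {g' : List A}, g <:+ g' → g ≠ g' → (G.ownSeq i g).length < (G.ownSeq i g').length := by
  intro g'
  induction g' with
  | nil => intro hs hne; exact absurd (List.suffix_nil.1 hs) hne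
  | cons b k ih =>
    intro hs hne
    have hs := (List.suffix_cons_iff.1 hs).resolve_left hne
    by_cases e : g = k
    · subst e
      simp [ownSeq, hg]
    · refine (ih hs e).trans_le ?_
      rw [ownSeq]
      split_ifs <;> simp

/-- Under perfect recall, a player who wants to reach an information set knows at every history
which action leads there, so that the counterfactual probabilities of reaching the histories of
an information set are the probabilities of incomparable events. -/
theorem sum_oppReach_infoset_le_one (G : EFG A I) (hG : G.PerfectRecall) {σ : Profile A I}
    (hσ : G.IsProfile σ) (i : Player) (s : I) : ∑ h ∈ G.infoset i s, G.oppReach σ i h ≤ 1 := by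
  rcases (G.infoset i s).eq_empty_or_nonempty with he | ⟨k, hk⟩
  · simp [he]
  set L := G.ownSeq i k with hL
  let F : List A → ℝ := fun h => if G.ownSeq i h <:+ L then G.oppReach σ i h else 0
  have hFs : ∀ h ∈ G.infoset i s, F h = G.oppReach σ i h := fun h hh => by
    have : G.ownSeq i h <:+ L := hG i s h hh k hk ▸ List.suffix_rfl
    simp only [F, if_pos this]
  have key := G.sum_antichain_le (F := F) ?_ ?_ (S := G.infoset i s)
    (fun h hh => (G.mem_infoset.1 hh).1) ?_ [] G.nil_mem
  · simpa [F, ownSeq, oppReach, Finset.sum_congr rfl hFs] using key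
  · intro h hh
    simp only [F]
    split_ifs
    · exact G.oppReach_nonneg hσ i h hh
    · exact le_rfl
  · intro h hh
    have h0 := G.oppReach_nonneg hσ i h hh
    by_cases hi : G.turn h = Turn.player i
    · simp only [F, ownSeq, oppReach, if_pos hi, mul_one]
      by_cases hq : G.ownSeq i h <:+ L
      · rw [if_pos hq]
        by_cases hex : ∃ a ∈ G.legal h, (G.info h, a) :: G.ownSeq i h <:+ L
        · obtain ⟨a, ha, has⟩ := hex
          rw [Finset.sum_eq_single_of_mem a ha, if_pos has]
          intro b _ hba
          refine if_neg fun hbs => hba ?_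
          have := (List.suffix_of_suffix_length_le hbs has (by simp)).eq_of_length (by simp)
          simpa using this
        · push Not at hex
          rw [Finset.sum_eq_zero fun a ha => if_neg (hex a ha)]
          exact h0
      · rw [if_neg hq, Finset.sum_eq_zero fun a _ => if_neg fun ha => hq
          ((List.suffix_cons _ _).trans ha)]
    · simp only [F, ownSeq, oppReach, if_neg hi]
      split_ifs
      · by_cases ht : G.turn h = Turn.terminal
        · simpa [G.legal_terminal ht] using h0
        · rw [← Finset.mul_sum, G.sum_stepProb hσ hh ht, mul_one]
      · simp
  · intro g hg g' hg' hs
    by_contra hne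
    have := G.ownSeq_length_lt (G.mem_infoset.1 hg).2.1 hs hne
    rw [hG i s g hg g' hg'] at this
    exact lt_irrefl _ this

/-! ### Regret matching -/

/-- The strategies in `σ` are distributions on the available actions at every label, including
those which do not occur in the game. -/
def IsFullProfile (G : EFG A I) (σ : Profile A I) : Prop :=
  ∀ i s, (∀ a, 0 ≤ σ i s a) ∧ (∀ a, a ∉ G.avail i s → σ i s a = 0) ∧
    ∑ a ∈ G.avail i s, σ i s a = 1

theorem IsFullProfile.isProfile {G : EFG A I} {σ : Profile A I} (h : G.IsFullProfile σ) :
    G.IsProfile σ := fun i s _ => h i s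

theorem uniform_isFullProfile (G : EFG A I) : G.IsFullProfile G.uniform := by
  intro i s
  refine ⟨fun a => ?_, fun a ha => if_neg ha, ?_⟩
  · simp only [uniform]
    split_ifs <;> positivity
  · have : ((G.avail i s).card : ℝ) ≠ 0 := by
      exact_mod_cast (G.avail_nonempty i s).card_pos.ne'
    have hu : ∀ a ∈ G.avail i s, G.uniform i s a = 1 / ((G.avail i s).card : ℝ) :=
      fun a ha => if_pos ha
    rw [Finset.sum_congr rfl hu]
    simp [this]

theorem regretMatching_isFullProfile (G : EFG A I) (R : Player → I → A → ℝ) :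
    G.IsFullProfile (G.regretMatching R) := by
  intro i s
  by_cases hp : 0 < ∑ b ∈ G.avail i s, max 0 (R i s b)
  · simp only [regretMatching, if_pos hp]
    refine ⟨fun a => ?_, fun a ha => if_neg ha, ?_⟩
    · split_ifs
      · exact div_nonneg (le_max_left _ _) hp.le
      · exact le_rfl
    · rw [Finset.sum_congr rfl fun a ha => if_pos ha, ← Finset.sum_div, div_self hp.ne']
  · simp only [regretMatching, if_neg hp]
    exact G.uniform_isFullProfile i s

theorem cfrStrategy_isFullProfile (G : EFG A I) (n : ℕ) : G.IsFullProfile (G.cfrStrategy n) :=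
  G.regretMatching_isFullProfile _

theorem abs_instRegret_le (G : EFG A I) (hG : G.PerfectRecall) {σ : Profile A I}
    (hσ : G.IsProfile σ) {Δ : ℝ} (hΔ0 : 0 ≤ Δ)
    (hΔ : ∀ z ∈ G.terminals, ∀ w ∈ G.terminals, G.payoff z - G.payoff w ≤ Δ) (i : Player) (s : I)
    {a : A} (ha : a ∈ G.avail i s) : |G.instRegret σ i s a| ≤ Δ := by
  have h1 : |G.instRegret σ i s a| ≤ ∑ h ∈ G.infoset i s, G.oppReach σ i h * Δ := by
    refine (Finset.abs_sum_le_sum_abs _ _).trans (Finset.sum_le_sum fun h hh => ?_)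
    obtain ⟨hh', ht, rfl⟩ := G.mem_infoset.1 hh
    have h0 := G.oppReach_nonneg hσ i h hh'
    rw [abs_mul, abs_of_nonneg h0]
    exact mul_le_mul_of_nonneg_left (G.abs_histValue_sub_le hσ i hΔ
      (G.cons_mem_hist.2 ⟨hh', (G.legal_player ht).symm ▸ ha⟩) hh') h0
  refine h1.trans ?_
  rw [← Finset.sum_mul]
  exact mul_le_of_le_one_left hΔ0 (G.sum_oppReach_infoset_le_one hG hσ i s)

/-- The regrets average to zero under the strategy that they refer to. -/
theorem sum_mul_instRegret (G : EFG A I) {σ : Profile A I} (hσ : G.IsFullProfile σ) (i : Player)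
    (s : I) : ∑ a ∈ G.avail i s, σ i s a * G.instRegret σ i s a = 0 := by
  simp only [instRegret, Finset.mul_sum]
  rw [Finset.sum_comm]
  refine Finset.sum_eq_zero fun h hh => ?_
  obtain ⟨hh, ht, rfl⟩ := G.mem_infoset.1 hh
  have hV := G.histValue_eq_sum σ i (h := h) (by simp [ht])
  rw [G.legal_player ht] at hV
  simp only [G.stepProb_player σ ht] at hV
  have : ∀ a, σ i (G.info h) a *
      (G.oppReach σ i h * (G.histValue σ i (a :: h) - G.histValue σ i h)) =
      G.oppReach σ i h * (σ i (G.info h) a * G.histValue σ i (a :: h) -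
        σ i (G.info h) a * G.histValue σ i h) := fun a => by ring
  simp only [this]
  rw [← Finset.mul_sum, Finset.sum_sub_distrib, ← hV, ← Finset.sum_mul, (hσ i _).2.2]
  ring

theorem cfrRegret_eq_sum (G : EFG A I) (n : ℕ) (i : Player) (s : I) (a : A) :
    G.cfrRegret n i s a = ∑ t ∈ range n, G.instRegret (G.cfrStrategy t) i s a := by
  induction n with
  | zero => simp [cfrRegret]
  | succ n ih => rw [Finset.sum_range_succ, ← ih, cfrRegret, cfrStrategy]

/-- Regret matching makes the current regret orthogonal to the positive part of the accumulated
regrets, so that the squared length of this positive part grows by at most the squared length of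
the current regret. -/
theorem sum_sq_cfrRegret_le (G : EFG A I) (hG : G.PerfectRecall) {Δ : ℝ} (hΔ0 : 0 ≤ Δ)
    (hΔ : ∀ z ∈ G.terminals, ∀ w ∈ G.terminals, G.payoff z - G.payoff w ≤ Δ) (i : Player) (s : I)
    (n : ℕ) :
    ∑ a ∈ G.avail i s, max 0 (G.cfrRegret n i s a) ^ 2 ≤ n * ((G.avail i s).card * Δ ^ 2) := by
  induction n with
  | zero => simp [cfrRegret]
  | succ n ih =>
    set R := G.cfrRegret n with hR
    set r := G.instRegret (G.cfrStrategy n) i s with hr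
    have hfull := G.cfrStrategy_isFullProfile n
    have hcross : ∑ a ∈ G.avail i s, max 0 (R i s a) * r a = 0 := by
      by_cases hp : 0 < ∑ b ∈ G.avail i s, max 0 (R i s b)
      · have h1 : ∀ a ∈ G.avail i s, max 0 (R i s a) * r a =
            (∑ b ∈ G.avail i s, max 0 (R i s b)) * (G.cfrStrategy n i s a * r a) := by
          intro a ha
          have : G.cfrStrategy n i s a =
              max 0 (R i s a) / ∑ b ∈ G.avail i s, max 0 (R i s b) := by
            simp only [cfrStrategy, regretMatching, ← hR, if_pos hp, if_pos ha]
          rw [this]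
          field_simp
        rw [Finset.sum_congr rfl h1, ← Finset.mul_sum, G.sum_mul_instRegret hfull, mul_zero]
      · have h0 : ∀ a ∈ G.avail i s, 0 ≤ max 0 (R i s a) := fun a _ => le_max_left _ _
        have := (Finset.sum_eq_zero_iff_of_nonneg h0).1
          (le_antisymm (not_lt.1 hp) (Finset.sum_nonneg h0))
        exact Finset.sum_eq_zero fun a ha => by rw [this a ha, zero_mul]
    have hstep : ∀ a ∈ G.avail i s, max 0 (G.cfrRegret (n + 1) i s a) ^ 2 ≤
        max 0 (R i s a) ^ 2 + 2 * (max 0 (R i s a) * r a) + Δ ^ 2 := by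
      intro a ha
      have hra : r a ^ 2 ≤ Δ ^ 2 :=
        sq_le_sq.2 (by
          rw [abs_of_nonneg hΔ0]
          exact G.abs_instRegret_le hG hfull.isProfile hΔ0 hΔ i s ha)
      have e : G.cfrRegret (n + 1) i s a = R i s a + r a := rfl
      have : max 0 (R i s a + r a) ^ 2 ≤ (max 0 (R i s a) + r a) ^ 2 := by
        rcases le_total (R i s a + r a) 0 with h | h
        · rw [max_eq_left h]
          simpa using sq_nonneg _
        · rw [max_eq_right h]
          exact pow_le_pow_left₀ h (by gcongr; exact le_max_right _ _) 2
      rw [e]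
      linarith
    refine (Finset.sum_le_sum hstep).trans ?_
    rw [Finset.sum_add_distrib, Finset.sum_add_distrib, ← Finset.mul_sum, hcross,
      Finset.sum_const, nsmul_eq_mul]
    push_cast
    linarith

theorem card_avail_le_maxActs (G : EFG A I) {i : Player} {s : I} (hs : s ∈ G.infosets i) :
    (G.avail i s).card ≤ G.maxActs :=
  (Finset.le_sup (f := fun s => (G.avail i s).card) hs).trans
    (Finset.le_sup (f := fun i => (G.infosets i).sup fun s => (G.avail i s).card) (mem_univ i))

theorem cfrRegret_le (G : EFG A I) (hG : G.PerfectRecall) {Δ : ℝ} (hΔ0 : 0 ≤ Δ)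
    (hΔ : ∀ z ∈ G.terminals, ∀ w ∈ G.terminals, G.payoff z - G.payoff w ≤ Δ) {i : Player} {s : I}
    (hs : s ∈ G.infosets i) (n : ℕ) {a : A} (ha : a ∈ G.avail i s) :
    G.cfrRegret n i s a ≤ Δ * √(n * G.maxActs) := by
  have h1 : max 0 (G.cfrRegret n i s a) ^ 2 ≤ n * ((G.avail i s).card * Δ ^ 2) :=
    (Finset.single_le_sum (f := fun a => max 0 (G.cfrRegret n i s a) ^ 2)
      (fun b _ => sq_nonneg _) ha).trans (G.sum_sq_cfrRegret_le hG hΔ0 hΔ i s n)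
  have h2 : ((G.avail i s).card : ℝ) ≤ G.maxActs := by
    exact_mod_cast G.card_avail_le_maxActs hs
  refine (le_max_right 0 _).trans (abs_le_of_sq_le_sq' ?_ (by positivity)).2
  rw [mul_pow, Real.sq_sqrt (by positivity)]
  calc _ ≤ _ := h1
    _ ≤ n * (G.maxActs * Δ ^ 2) := by gcongr
    _ = _ := by ring

/-- The total regret of a player in `n` iterations of CFR. -/
theorem sum_value_update_sub_le (G : EFG A I) (hG : G.PerfectRecall) {Δ : ℝ} (hΔ0 : 0 ≤ Δ)
    (hΔ : ∀ z ∈ G.terminals, ∀ w ∈ G.terminals, G.payoff z - G.payoff w ≤ Δ) {i : Player}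
    {ρ : I → A → ℝ} (hρ : G.IsStrategyOf i ρ) (n : ℕ) :
    ∑ t ∈ range n, (G.value (Function.update (G.cfrStrategy t) i ρ) i -
      G.value (G.cfrStrategy t) i) ≤ (G.infosets i).card * (Δ * √(n * G.maxActs)) := by
  obtain ⟨w, hw, hval⟩ := G.value_update_sub_eq_sum_instRegret hG hρ
  simp only [hval]
  rw [Finset.sum_comm, ← nsmul_eq_mul]
  refine Finset.sum_le_card_nsmul _ _ _ fun s hs => ?_
  obtain ⟨p0, -, p1⟩ := hρ s hs
  obtain ⟨w0, w1⟩ := hw s hs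
  have hB : 0 ≤ Δ * √(n * G.maxActs) := by positivity
  have : ∑ t ∈ range n, w s * ∑ a ∈ G.avail i s, ρ s a * G.instRegret (G.cfrStrategy t) i s a =
      w s * ∑ a ∈ G.avail i s, ρ s a * G.cfrRegret n i s a := by
    rw [← Finset.mul_sum, Finset.sum_comm]
    simp only [cfrRegret_eq_sum, Finset.mul_sum]
  rw [this]
  refine (mul_le_mul_of_nonneg_left (Finset.sum_le_sum fun a ha =>
    mul_le_mul_of_nonneg_left (G.cfrRegret_le hG hΔ0 hΔ hs n ha) (p0 a)) w0).trans ?_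
  rw [← Finset.sum_mul, p1, one_mul]
  exact mul_le_of_le_one_left hB w1

/-! ### The average strategy -/

theorem infoWeight_nonneg (G : EFG A I) {σ : Profile A I} (hσ : G.IsProfile σ) (i : Player)
    (s : I) : 0 ≤ G.infoWeight σ i s :=
  Finset.sum_nonneg fun h hh => (G.ownReach_mem_Icc (hσ i) h (G.mem_infoset.1 hh).1).1

theorem cfrAverage_isFullProfile (G : EFG A I) (n : ℕ) : G.IsFullProfile (G.cfrAverage n) := by
  intro i s
  by_cases hp : 0 < ∑ t ∈ range n, G.infoWeight (G.cfrStrategy t) i s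
  · simp only [cfrAverage, if_pos hp]
    refine ⟨fun a => ?_, fun a ha => ?_, ?_⟩
    · exact div_nonneg (Finset.sum_nonneg fun t _ => mul_nonneg
        (G.infoWeight_nonneg (G.cfrStrategy_isFullProfile t).isProfile i s)
        ((G.cfrStrategy_isFullProfile t i s).1 a)) hp.le
    · simp [(G.cfrStrategy_isFullProfile _ i s).2.1 a ha]
    · rw [← Finset.sum_div, Finset.sum_comm]
      simp only [← Finset.mul_sum, (G.cfrStrategy_isFullProfile _ i s).2.2, mul_one]
      exact div_self hp.ne'
  · simp only [cfrAverage, if_neg hp]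
    exact G.uniform_isFullProfile i s

/-- The average strategy is realization equivalent to the mixture of the strategies that are
averaged. -/
theorem sum_ownReach_cfrStrategy (G : EFG A I) (hG : G.PerfectRecall) (n : ℕ) (i : Player) :
    ∀ h ∈ G.hist, ∑ t ∈ range n, G.ownReach (G.cfrStrategy t) i h =
      n * G.ownReach (G.cfrAverage n) i h := by
  intro h
  induction h with
  | nil => intro _; simp [ownReach]
  | cons a h ih =>
    intro hh
    obtain ⟨hh, ha⟩ := G.cons_mem_hist.1 hh
    have ih := ih hh
    simp only [ownReach]
    by_cases ht : G.turn h = Turn.player i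
    · simp only [if_pos ht]
      have hmem : h ∈ G.infoset i (G.info h) := G.mem_infoset.2 ⟨hh, ht, rfl⟩
      have hcard : (0 : ℝ) < (G.infoset i (G.info h)).card := by
        exact_mod_cast Finset.card_pos.2 ⟨h, hmem⟩
      have hw : ∀ t, G.infoWeight (G.cfrStrategy t) i (G.info h) =
          (G.infoset i (G.info h)).card * G.ownReach (G.cfrStrategy t) i h :=
        fun t => G.infoWeight_eq hG _ hmem
      have h0 : ∀ t ∈ range n, 0 ≤ G.ownReach (G.cfrStrategy t) i h := fun t _ =>
        (G.ownReach_mem_Icc ((G.cfrStrategy_isFullProfile t).isProfile i) h hh).1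
      by_cases hp : 0 < ∑ t ∈ range n, G.ownReach (G.cfrStrategy t) i h
      · have hp' : 0 < ∑ t ∈ range n, G.infoWeight (G.cfrStrategy t) i (G.info h) := by
          simp only [hw, ← Finset.mul_sum]
          positivity
        rw [← mul_assoc, ← ih]
        simp only [cfrAverage, if_pos hp']
        simp only [hw, mul_assoc, ← Finset.mul_sum]
        field_simp
      · have hz := le_antisymm (not_lt.1 hp) (Finset.sum_nonneg h0)
        rw [← mul_assoc, ← ih, hz, zero_mul]
        have := (Finset.sum_eq_zero_iff_of_nonneg h0).1 hz
        exact Finset.sum_eq_zero fun t ht => by rw [this t ht, zero_mul]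
    · simpa [if_neg ht] using ih

theorem sum_value_update_cfrStrategy (G : EFG A I) (hG : G.PerfectRecall) (n : ℕ) (i : Player)
    (ρ : I → A → ℝ) : ∑ t ∈ range n, G.value (Function.update (G.cfrStrategy t) i ρ) i =
      n * G.value (Function.update (G.cfrAverage n) i ρ) i := by
  simp only [value]
  rw [Finset.sum_comm, Finset.mul_sum]
  refine Finset.sum_congr rfl fun z hz => ?_
  have hz := (G.mem_terminals.1 hz).1
  have hr : ∀ σ : Profile A I, G.reach (Function.update σ i ρ) z * G.util i z =
      G.ownReach (fun _ => ρ) i z * G.chanceReach z * G.util i z * G.ownReach σ (1 - i) z := by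
    intro σ
    rw [G.reach_eq_ownReach_mul_oppReach _ i, G.oppReach_update,
      oppReach_eq_chanceReach_mul_ownReach,
      G.ownReach_congr (σ := Function.update σ i ρ) (τ := fun _ => ρ) (by simp)]
    ring
  simp only [hr, ← Finset.mul_sum]
  rw [G.sum_ownReach_cfrStrategy hG n _ z hz]
  ring

/-- Together, the two players can gain at most the average of the sum of their regrets by
deviating from the average strategies. -/
theorem sum_value_update_cfrAverage_le (G : EFG A I) (hG : G.PerfectRecall) {Δ : ℝ} (hΔ0 : 0 ≤ Δ)
    (hΔ : ∀ z ∈ G.terminals, ∀ w ∈ G.terminals, G.payoff z - G.payoff w ≤ Δ)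
    {ρ : Profile A I} (hρ : G.IsProfile ρ) (n : ℕ) :
    n * ∑ i, G.value (Function.update (G.cfrAverage n) i (ρ i)) i ≤
      G.size * (Δ * √(n * G.maxActs)) := by
  have h0 := G.sum_value_update_sub_le hG hΔ0 hΔ (hρ 0) n
  have h1 := G.sum_value_update_sub_le hG hΔ0 hΔ (hρ 1) n
  have hz : ∀ σ : Profile A I, G.value σ 1 = - G.value σ 0 := fun σ => G.value_opponent σ 0
  rw [Finset.sum_sub_distrib, sum_value_update_cfrStrategy G hG] at h0 h1
  simp only [hz (G.cfrStrategy _), Finset.sum_neg_distrib] at h1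
  simp only [size, Fin.sum_univ_two, Nat.cast_add]
  linarith

/-- After `Δ² * maxActs * size² / ε²` iterations of CFR the players can gain at most `ε`. -/
theorem sum_value_update_cfrAverage_le_of_le (G : EFG A I) (hG : G.PerfectRecall) {Δ ε : ℝ}
    (hΔ0 : 0 ≤ Δ) (hε : 0 < ε)
    (hΔ : ∀ z ∈ G.terminals, ∀ w ∈ G.terminals, G.payoff z - G.payoff w ≤ Δ)
    {ρ : Profile A I} (hρ : G.IsProfile ρ) {n : ℕ} (hn : 0 < n)
    (hle : Δ ^ 2 * G.maxActs * G.size ^ 2 / ε ^ 2 ≤ n) :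
    ∑ i, G.value (Function.update (G.cfrAverage n) i (ρ i)) i ≤ ε := by
  have hn' : (0 : ℝ) < n := by exact_mod_cast hn
  refine le_of_mul_le_mul_left ((G.sum_value_update_cfrAverage_le hG hΔ0 hΔ hρ n).trans ?_) hn'
  rw [div_le_iff₀ (by positivity)] at hle
  refine (abs_le_of_sq_le_sq' ?_ (by positivity)).2
  rw [mul_pow, mul_pow, Real.sq_sqrt (by positivity)]
  nlinarith

/-! ### Restricted games inside the whole game -/

theorem terminals_nonempty (G : EFG A I) : G.terminals.Nonempty := by
  refine G.hist_induction (P := fun _ => G.terminals.Nonempty) (fun h hh ih => ?_) [] G.nil_mem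
  by_cases ht : G.turn h = Turn.terminal
  · exact ⟨h, G.mem_terminals.2 ⟨hh, ht⟩⟩
  · have hs := G.sum_stepProb G.uniform_isFullProfile.isProfile hh ht
    obtain ⟨a, ha⟩ := Finset.nonempty_of_sum_ne_zero (hs.trans_ne one_ne_zero)
    exact ih a ha

theorem mem_hist_restrict (G : EFG A I) {B : G.Population} {h : List A} :
    h ∈ (G.restrict B).hist ↔ h ∈ G.hist ∧ B.Allows h := by
  simp [restrict]

theorem mem_terminals_restrict (G : EFG A I) {B : G.Population} {z : List A} :
    z ∈ (G.restrict B).terminals ↔ z ∈ G.terminals ∧ B.Allows z := by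
  rw [mem_terminals, mem_terminals, mem_hist_restrict]
  change _ ∧ G.turn z = _ ↔ _
  tauto

theorem Population.Allows.mono {G : EFG A I} {B B' : G.Population}
    (hB : ∀ i s, B.acts i s ⊆ B'.acts i s) : ∀ {h : List A}, B.Allows h → B'.Allows h := by
  intro h
  induction h with
  | nil => exact fun _ => trivial
  | cons a h ih => exact fun hh => ⟨ih hh.1, fun i ht => hB i _ (hh.2 i ht)⟩

theorem infosets_restrict_subset (G : EFG A I) (B : G.Population) (i : Player) :
    (G.restrict B).infosets i ⊆ G.infosets i :=
  image_subset_image fun _ hh =>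
    mem_filter.2 ⟨(G.mem_hist_restrict.1 (mem_filter.1 hh).1).1, (mem_filter.1 hh).2⟩

theorem infosets_restrict_mono (G : EFG A I) {B B' : G.Population}
    (hB : ∀ i s, B.acts i s ⊆ B'.acts i s) (i : Player) :
    (G.restrict B).infosets i ⊆ (G.restrict B').infosets i := by
  refine image_subset_image fun h hh => ?_
  obtain ⟨hh, ht⟩ := mem_filter.1 hh
  obtain ⟨hh, ha⟩ := G.mem_hist_restrict.1 hh
  exact mem_filter.2 ⟨G.mem_hist_restrict.2 ⟨hh, ha.mono hB⟩, ht⟩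

theorem size_restrict_le (G : EFG A I) (B : G.Population) : (G.restrict B).size ≤ G.size :=
  Finset.sum_le_sum fun i _ => Finset.card_le_card (G.infosets_restrict_subset B i)

theorem size_restrict_mono (G : EFG A I) {B B' : G.Population}
    (hB : ∀ i s, B.acts i s ⊆ B'.acts i s) : (G.restrict B).size ≤ (G.restrict B').size :=
  Finset.sum_le_sum fun i _ => Finset.card_le_card (G.infosets_restrict_mono hB i)

theorem maxActs_restrict_le (G : EFG A I) (B : G.Population) :
    (G.restrict B).maxActs ≤ G.maxActs :=
  Finset.sup_le fun i _ => Finset.sup_le fun s hs =>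
    (Finset.card_le_card (B.subset i s)).trans
      (G.card_avail_le_maxActs (G.infosets_restrict_subset B i hs))

theorem ownSeq_restrict (G : EFG A I) (B : G.Population) (i : Player) (h : List A) :
    (G.restrict B).ownSeq i h = G.ownSeq i h := by
  induction h with
  | nil => rfl
  | cons a h ih =>
    simp only [ownSeq, ih]
    rfl

theorem PerfectRecall.restrict {G : EFG A I} (hG : G.PerfectRecall) (B : G.Population) :
    (G.restrict B).PerfectRecall := by
  have hsub : ∀ i s, ∀ h ∈ (G.restrict B).infoset i s, h ∈ G.infoset i s := fun i s h hh => by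
    obtain ⟨h1, h2⟩ := mem_filter.1 hh
    exact mem_filter.2 ⟨(G.mem_hist_restrict.1 h1).1, h2⟩
  intro i s h hh g hg
  rw [ownSeq_restrict, ownSeq_restrict]
  exact hG i s h (hsub i s h hh) g (hsub i s g hg)

theorem reach_restrict (G : EFG A I) (B : G.Population) (σ : Profile A I) (h : List A) :
    (G.restrict B).reach σ h = G.reach σ h := by
  induction h with
  | nil => rfl
  | cons a h ih =>
    simp only [reach, ih]
    rfl

/-- Strategies that only use actions from the population never leave the restricted game, and so
have the same value there. -/
theorem value_restrict (G : EFG A I) (B : G.Population) {σ : Profile A I}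
    (hσ : ∀ i, ∀ s ∈ G.infosets i, ∀ a, a ∉ B.acts i s → σ i s a = 0) (i : Player) :
    (G.restrict B).value σ i = G.value σ i := by
  have hz : ∀ h ∈ G.hist, ¬ B.Allows h → G.reach σ h = 0 := by
    intro h
    induction h with
    | nil => intro _ hn; exact absurd trivial hn
    | cons a h ih =>
      intro hh hn
      obtain ⟨hh, -⟩ := G.cons_mem_hist.1 hh
      by_cases hB : B.Allows h
      · obtain ⟨j, ht, ha⟩ : ∃ j, G.turn h = Turn.player j ∧ a ∉ B.acts j (G.info h) := by
          by_contra! hc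
          exact hn ⟨hB, hc⟩
        rw [reach, G.stepProb_player σ ht, hσ j _ (G.info_mem_infosets hh ht) a ha, mul_zero]
      · rw [reach, ih hh hB, zero_mul]
  unfold value
  simp only [reach_restrict]
  refine Finset.sum_subset (fun z hz => (G.mem_terminals_restrict.1 hz).1) fun z hzG hzB => ?_
  rw [hz z (G.mem_terminals.1 hzG).1 fun ha => hzB (G.mem_terminals_restrict.2 ⟨hzG, ha⟩),
    zero_mul]

theorem IsFullProfile.of_restrict {G : EFG A I} {B : G.Population} {σ : Profile A I}
    (hσ : (G.restrict B).IsFullProfile σ) : G.IsProfile σ := by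
  intro i s _
  obtain ⟨h0, h1, h2⟩ := hσ i s
  refine ⟨h0, fun a ha => h1 a fun hB => ha (B.subset i s hB), ?_⟩
  rw [← h2]
  exact (Finset.sum_subset (B.subset i s) fun a _ ha => h1 a ha).symm

/-! ### Best responses and equilibria -/

/-- In a zero-sum game, it suffices that the sum of the values of the best responses of the two
players is small. -/
theorem isEpsNash_of_sum_value_le (G : EFG A I) {σ : Profile A I} (hσ : G.IsProfile σ) {ε : ℝ}
    {p : G.PureProfile} (hp : ∀ i, G.IsBestResponse σ p i)
    (hsum : ∑ i, G.value (Function.update σ i (pureStrategy p i)) i ≤ ε) :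
    G.IsEpsNash ε σ := by
  have hself : ∀ i, G.value σ i ≤ G.value (Function.update σ i (pureStrategy p i)) i := fun i => by
    simpa using hp i (σ i) (hσ i)
  have hgain : ∀ i ρ, G.IsStrategyOf i ρ →
      G.value (Function.update σ i ρ) i ≤ G.value σ i + ε := by
    intro i ρ hρ
    have h1 := hp i ρ hρ
    have h2 := hself (1 - i)
    rw [value_opponent] at h2
    have h3 : ∑ j, G.value (Function.update σ j (pureStrategy p j)) j =
        G.value (Function.update σ i (pureStrategy p i)) i +
          G.value (Function.update σ (1 - i) (pureStrategy p (1 - i))) (1 - i) := by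
      fin_cases i
      · simp [Fin.sum_univ_two]
      · simp [Fin.sum_univ_two, add_comm]
    linarith
  refine ⟨hσ, fun i => ⟨fun ρ hρ => ?_, fun ρ hρ => by linarith [hgain i ρ hρ]⟩⟩
  have := hgain (1 - i) ρ hρ
  rw [value_opponent, value_opponent] at this
  linarith

theorem pureStrategy_isStrategyOf (G : EFG A I) (B : G.Population) {p : G.PureProfile} {i : Player}
    (hp : ∀ s ∈ G.infosets i, (p i s : A) ∈ B.acts i s) :
    (G.restrict B).IsStrategyOf i (pureStrategy p i) := by
  intro s hs
  have hmem := hp s (G.infosets_restrict_subset B i hs)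
  refine ⟨fun a => ?_, fun a ha => if_neg fun e => ha (by rwa [e]), ?_⟩
  · unfold pureStrategy
    split_ifs <;> norm_num
  · change ∑ a ∈ B.acts i s, _ = _
    simp [pureStrategy, hmem]

theorem Population.mem_of_add_eq {G : EFG A I} {B : G.Population} {p : G.PureProfile}
    (h : B.add p = B) (i : Player) {s : I} (hs : s ∈ G.infosets i) : (p i s : A) ∈ B.acts i s := by
  have := congrArg (fun B : G.Population => B.acts i s) h
  simp only [Population.add, if_pos hs] at this
  exact insert_eq_self.1 this

theorem State.las_isProfile {G : EFG A I} (S : G.State) : G.IsProfile S.las :=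
  (S.game.cfrAverage_isFullProfile _).of_restrict

/-- If best responses to the average strategies do not leave the restricted game, then the average
strategies are as close to an equilibrium in the whole game as they are in the restricted game. -/
theorem State.isEpsNash_las {G : EFG A I} (hG : G.PerfectRecall) {Δ ε : ℝ} (hε : 0 < ε)
    (hΔ : ∀ z ∈ G.terminals, ∀ w ∈ G.terminals, G.payoff z - G.payoff w ≤ Δ) (S : G.State)
    {p : G.PureProfile} (hp : ∀ i, G.IsBestResponse S.las p i) (hadd : S.pop.add p = S.pop)
    (hle : Δ ^ 2 * G.maxActs * S.game.size ^ 2 / ε ^ 2 ≤ (S.len + 1 : ℕ)) :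
    G.IsEpsNash ε S.las := by
  have hΔ0 : 0 ≤ Δ := by
    obtain ⟨z, hz⟩ := G.terminals_nonempty
    simpa using hΔ z hz z hz
  have hmem := fun i s hs => Population.mem_of_add_eq hadd i (s := s) hs
  have hsupp := fun i s => (S.game.cfrAverage_isFullProfile (S.len + 1) i s).2.1
  have hstrat : ∀ i, S.game.IsStrategyOf i (pureStrategy p i) := fun i =>
    G.pureStrategy_isStrategyOf S.pop (hmem i)
  have hmax : Δ ^ 2 * S.game.maxActs * S.game.size ^ 2 / ε ^ 2 ≤ (S.len + 1 : ℕ) := by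
    refine le_trans ?_ hle
    have : (S.game.maxActs : ℝ) ≤ G.maxActs := by exact_mod_cast G.maxActs_restrict_le S.pop
    gcongr
  refine G.isEpsNash_of_sum_value_le S.las_isProfile hp ?_
  refine le_trans (le_of_eq (Finset.sum_congr rfl fun i _ => ?_))
    (S.game.sum_value_update_cfrAverage_le_of_le (hG.restrict S.pop) hΔ0 hε
      (fun z hz w hw => hΔ z (G.mem_terminals_restrict.1 hz).1 w (G.mem_terminals_restrict.1 hw).1)
      (ρ := pureStrategy p) hstrat S.len.succ_pos hmax)
  refine (G.value_restrict S.pop (fun j s hs a ha => ?_) i).symm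
  by_cases hj : j = i
  · subst hj
    rw [Function.update_self]
    exact if_neg fun e => ha (by rw [e]; exact hmem j s hs)
  · rw [Function.update_of_ne hj]
    exact hsupp j s a ha

/-! ### The run of RMDO -/

theorem rmdo_succ (G : EFG A I) (m : ℕ → ℕ) (br : ℕ → Profile A I → G.PureProfile) {t : ℕ}
    (ht : 1 ≤ t) : G.rmdo m br (t + 1) = G.step m br t (G.rmdo m br t) := by
  obtain ⟨t, rfl⟩ := Nat.exists_eq_add_of_le' ht
  rfl

theorem Population.acts_subset_add {G : EFG A I} (B : G.Population) (p : G.PureProfile)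
    (i : Player) (s : I) : B.acts i s ⊆ (B.add p).acts i s := by
  simp only [Population.add]
  split_ifs
  · exact subset_insert _ _
  · exact Subset.rfl

theorem acts_rmdo_mono (G : EFG A I) (m : ℕ → ℕ) (br : ℕ → Profile A I → G.PureProfile) {r t : ℕ}
    (hr : 1 ≤ r) (hrt : r ≤ t) (i : Player) (s : I) :
    (G.rmdo m br r).pop.acts i s ⊆ (G.rmdo m br t).pop.acts i s := by
  induction t, hrt using Nat.le_induction with
  | base => exact Subset.rfl
  | succ t hrt ih =>
    refine ih.trans ?_
    rw [G.rmdo_succ m br (hr.trans hrt), step]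
    split_ifs
    · exact Population.acts_subset_add _ _ i s
    · exact Subset.rfl

theorem windowSize_mono (G : EFG A I) (m : ℕ → ℕ) (br : ℕ → Profile A I → G.PureProfile) {r t : ℕ}
    (hr : 1 ≤ r) (hrt : r ≤ t) : G.windowSize m br r ≤ G.windowSize m br t :=
  G.size_restrict_mono (G.acts_rmdo_mono m br hr hrt)

/-- The number of actions in a population, at the information sets of the game. Every new window
increases it. -/
noncomputable def Population.total {G : EFG A I} (B : G.Population) : ℕ :=
  ∑ i, ∑ s ∈ G.infosets i, (B.acts i s).card

theorem Population.total_lt_total_add {G : EFG A I} {B : G.Population} {p : G.PureProfile}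
    (h : B.add p ≠ B) : B.total < (B.add p).total := by
  obtain ⟨i, s, hs, ha⟩ : ∃ i, ∃ s ∈ G.infosets i, (p i s : A) ∉ B.acts i s := by
    by_contra! hc
    refine h (Population.ext ?_)
    funext i s
    simp only [Population.add]
    split_ifs with hs
    · exact insert_eq_self.2 (hc i s hs)
    · rfl
  have hcard : ∀ i s, (B.acts i s).card ≤ ((B.add p).acts i s).card := fun i s =>
    Finset.card_le_card (B.acts_subset_add p i s)
  refine Finset.sum_lt_sum (fun j _ => Finset.sum_le_sum fun s _ => hcard j s) ⟨i, mem_univ i, ?_⟩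
  refine Finset.sum_lt_sum (fun s _ => hcard i s) ⟨s, hs, ?_⟩
  simp [Population.add, hs, ha]

theorem win_rmdo_le (G : EFG A I) (m : ℕ → ℕ) (br : ℕ → Profile A I → G.PureProfile) {t : ℕ}
    (ht : 1 ≤ t) : (G.rmdo m br t).win ≤ ∑ i, ∑ s ∈ G.infosets i, (G.avail i s).card := by
  have key : (G.rmdo m br t).win ≤ (G.rmdo m br t).pop.total := by
    induction t, ht using Nat.le_induction with
    | base => exact Nat.zero_le _
    | succ t ht ih =>
      rw [G.rmdo_succ m br ht, step]
      split_ifs with hc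
      · exact ih.trans_lt (Population.total_lt_total_add hc.2)
      · exact ih
  exact key.trans (Finset.sum_le_sum fun i _ => Finset.sum_le_sum fun s _ =>
    Finset.card_le_card ((G.rmdo m br t).pop.subset i s))

/-- The number of the first `t` iterations in which best responses are computed. -/
noncomputable def numBR (G : EFG A I) (m : ℕ → ℕ) (br : ℕ → Profile A I → G.PureProfile)
    (t : ℕ) : ℕ :=
  ∑ r ∈ Icc 1 t, if G.ComputesBR m br r then 1 else 0

theorem numBR_succ (G : EFG A I) (m : ℕ → ℕ) (br : ℕ → Profile A I → G.PureProfile) (t : ℕ) :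
    G.numBR m br (t + 1) + t / m (G.rmdo m br (t + 1)).win =
      G.numBR m br t + (t + 1) / m (G.rmdo m br (t + 1)).win := by
  rw [numBR, Finset.sum_Icc_succ_top (by omega), ← numBR, Nat.succ_div]
  have hiff : G.ComputesBR m br (t + 1) ↔ m (G.rmdo m br (t + 1)).win ∣ t + 1 :=
    Nat.dvd_iff_mod_eq_zero.symm
  by_cases hd : m (G.rmdo m br (t + 1)).win ∣ t + 1
  · rw [if_pos (hiff.2 hd), if_pos hd]
    omega
  · rw [if_neg (fun h => hd (hiff.1 h)), if_neg hd]
    omega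

/-- A window has at most `D + M` iterations, with at most `D / M + 2` multiples of `M`, if
it starts after iteration `s`, has reached iteration `t + 1`, and contains no multiple of `M` from
`s + D` to `t`, the point `s + D` excluded. -/
theorem window_length_le {s t M : ℕ} (hM : 0 < M) {D : ℝ} (hlast : ((t / M * M : ℕ) : ℝ) ≤ s + D) :
    ((t + 1 : ℕ) : ℝ) ≤ s + (D + M) ∧
      (((t + 1) / M : ℕ) : ℝ) ≤ ((s / M : ℕ) : ℝ) + (D / M + 2) := by
  have hM' : (0 : ℝ) < M := by exact_mod_cast hM
  have h1 : ((t + 1 : ℕ) : ℝ) ≤ (t / M * M : ℕ) + M := by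
    have := Nat.div_add_mod' t M
    have := Nat.mod_lt t hM
    exact_mod_cast (by omega : t + 1 ≤ t / M * M + M)
  have h2 : ((t + 1 : ℕ) : ℝ) ≤ s + (D + M) := by linarith
  refine ⟨h2, ?_⟩
  have h3 : (((t + 1) / M : ℕ) : ℝ) ≤ ((t + 1 : ℕ) : ℝ) / M := Nat.cast_div_le
  have h4 : (s : ℝ) / M ≤ ((s / M : ℕ) : ℝ) + 1 := by
    rw [div_le_iff₀ hM']
    have := Nat.div_add_mod' s M
    have := Nat.mod_lt s hM
    exact_mod_cast (by rw [add_mul]; omega : s ≤ (s / M + 1) * M)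
  have h5 : ((t + 1 : ℕ) : ℝ) / M ≤ (s + (D + M)) / M := by gcongr
  have h6 : ((s : ℝ) + (D + M)) / M = s / M + D / M + 1 := by field_simp; ring
  linarith

/-- If in every window the population grows at all computations of best responses after more than
`D` iterations, then the window with frequency `m j` has at most `D + m j` iterations and
at most `D / m j + 2` computations of best responses. -/
theorem iterations_and_numBR_le (G : EFG A I) {m : ℕ → ℕ} (br : ℕ → Profile A I → G.PureProfile)
    (hm : ∀ j, 0 < m j) {D : ℝ} (hD : 0 ≤ D) {T : ℕ} (hT : 1 ≤ T)
    (H : ∀ r, 1 ≤ r → r < T → G.ComputesBR m br r →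
      (G.rmdo m br r).pop.add (br r (G.rmdo m br r).las) = (G.rmdo m br r).pop →
      (((G.rmdo m br r).len + 1 : ℕ) : ℝ) ≤ D) :
    (T : ℝ) ≤ ∑ j ∈ range (G.numWindows m br T), (D + m j) ∧
      (G.numBR m br T : ℝ) ≤ ∑ j ∈ range (G.numWindows m br T), (D / m j + 2) := by
  -- `P t` describes the state at the start of iteration `t + 1`, where `s` is the last iteration
  -- before the current window. The left side of the last clause is the last multiple of the
  -- current frequency up to `t`. If it exceeds `s`, it lies in the current window, where `H`
  -- applies to it because the window did not end there.
  let P : ℕ → Prop := fun t => ∃ s : ℕ, t + 1 = s + (G.rmdo m br (t + 1)).len + 1 ∧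
    (s : ℝ) ≤ ∑ j ∈ range (G.rmdo m br (t + 1)).win, (D + m j) ∧
    (G.numBR m br (t + 1) : ℝ) + (s / m (G.rmdo m br (t + 1)).win : ℕ) ≤
      ∑ j ∈ range (G.rmdo m br (t + 1)).win, (D / m j + 2) +
        ((t + 1) / m (G.rmdo m br (t + 1)).win : ℕ) ∧
    ((t / m (G.rmdo m br (t + 1)).win * m (G.rmdo m br (t + 1)).win : ℕ) : ℝ) ≤ s + D
  have bound : ∀ t, P t →
      ((t + 1 : ℕ) : ℝ) ≤ ∑ j ∈ range ((G.rmdo m br (t + 1)).win + 1), (D + m j) ∧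
      (G.numBR m br (t + 1) : ℝ) ≤
        ∑ j ∈ range ((G.rmdo m br (t + 1)).win + 1), (D / m j + 2) := by
    rintro t ⟨s, -, h2, h3, h4⟩
    obtain ⟨h5, h6⟩ := window_length_le (hm _) h4
    rw [Finset.sum_range_succ, Finset.sum_range_succ]
    constructor <;> linarith
  have hP : ∀ t, t < T → P t := by
    intro t
    induction t with
    | zero =>
      intro _
      have h0 := G.numBR_succ m br 0
      have e : (G.rmdo m br (0 + 1)).win = 0 := rfl
      refine ⟨0, rfl, by simp [e], ?_, by simpa using hD⟩
      have h1 : G.numBR m br 0 = 0 := rfl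
      rw [h1, zero_add] at h0
      rw [e] at h0 ⊢
      rw [Finset.sum_range_zero, zero_add]
      exact_mod_cast h0.le
    | succ t ih =>
      intro hlt
      have hPt := ih (by omega)
      obtain ⟨hb1, hb2⟩ := bound t hPt
      obtain ⟨s, h1, h2, h3, h4⟩ := hPt
      have hB : (G.numBR m br (t + 1 + 1) : ℝ) +
          ((t + 1) / m (G.rmdo m br (t + 1 + 1)).win : ℕ) = (G.numBR m br (t + 1) : ℝ) +
          ((t + 1 + 1) / m (G.rmdo m br (t + 1 + 1)).win : ℕ) := by
        exact_mod_cast G.numBR_succ m br (t + 1)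
      have hstep := G.rmdo_succ m br (t := t + 1) (by omega)
      rw [step] at hstep
      split_ifs at hstep with hc
      · refine ⟨t + 1, by simp [hstep], ?_, ?_, ?_⟩
        · rw [hstep]; exact hb1
        · rw [hB]
          have e : (G.rmdo m br (t + 1 + 1)).win = (G.rmdo m br (t + 1)).win + 1 := by rw [hstep]
          rw [e]
          linarith
        · have := Nat.div_mul_le_self (t + 1) (m (G.rmdo m br (t + 1 + 1)).win)
          have : (((t + 1) / m (G.rmdo m br (t + 1 + 1)).win *
              m (G.rmdo m br (t + 1 + 1)).win : ℕ) : ℝ) ≤ (t + 1 : ℕ) := by exact_mod_cast this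
          linarith
      · have e : (G.rmdo m br (t + 1 + 1)).win = (G.rmdo m br (t + 1)).win := by rw [hstep]
        refine ⟨s, by rw [hstep]; simp only; omega, by rw [e]; exact h2, ?_, ?_⟩
        · rw [e] at hB ⊢
          linarith
        · rw [e]
          by_cases hd : (t + 1) % m (G.rmdo m br (t + 1)).win = 0
          · have hadd := not_not.1 fun hne => hc ⟨hd, hne⟩
            have hlen := H (t + 1) (by omega) (by omega) hd hadd
            have := Nat.div_mul_le_self (t + 1) (m (G.rmdo m br (t + 1)).win)
            have hle : (((t + 1) / m (G.rmdo m br (t + 1)).win *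
                m (G.rmdo m br (t + 1)).win : ℕ) : ℝ) ≤
                s + ((G.rmdo m br (t + 1)).len + 1 : ℕ) := by
              exact_mod_cast (by omega : _ ≤ s + ((G.rmdo m br (t + 1)).len + 1))
            linarith
          · rw [Nat.succ_div, if_neg (by rwa [Nat.dvd_iff_mod_eq_zero]), add_zero]
            exact h4
  obtain ⟨T, rfl⟩ := Nat.exists_eq_add_of_le' hT
  exact bound T (hP T (by omega))

theorem samples_le_windowSize_mul (G : EFG A I) (m : ℕ → ℕ)
    (br : ℕ → Profile A I → G.PureProfile) {T : ℕ} (hT : 1 ≤ T) :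
    G.samples m br T ≤ G.windowSize m br T * (1 + T + G.numBR m br T) := by
  have h1 : ∀ r ∈ Icc 1 T, G.windowSize m br r +
      (if G.ComputesBR m br r then G.windowSize m br r else 0) ≤
      G.windowSize m br T * (1 + if G.ComputesBR m br r then 1 else 0) := by
    intro r hr
    have := G.windowSize_mono m br (mem_Icc.1 hr).1 (mem_Icc.1 hr).2
    split_ifs <;> omega
  have h2 := Finset.sum_le_sum h1
  have hb : ∑ r ∈ Icc 1 T, (1 + if G.ComputesBR m br r then 1 else 0) =
      T + G.numBR m br T := by
    simp [numBR, Finset.sum_add_distrib]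
  rw [← Finset.mul_sum, hb] at h2
  have h3 := G.windowSize_mono m br le_rfl hT
  calc G.samples m br T ≤
        G.windowSize m br T + G.windowSize m br T * (T + G.numBR m br T) :=
      Nat.add_le_add h3 h2
    _ = _ := by ring

/-- The population grows whenever best responses are computed after more than
`Δ² * maxActs * size² / ε²` iterations in a window, unless the average strategies are an
`ε`-equilibrium. -/
theorem len_le_of_add_eq (G : EFG A I) (hG : G.PerfectRecall) {m : ℕ → ℕ}
    {br : ℕ → Profile A I → G.PureProfile} (hbr : G.IsOracle br) {Δ ε : ℝ} (hε : 0 < ε)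
    (hΔ : ∀ z ∈ G.terminals, ∀ w ∈ G.terminals, G.payoff z - G.payoff w ≤ Δ) {X r : ℕ}
    (hX : G.windowSize m br r ≤ X) (hN : ¬ G.IsEpsNash ε (G.las m br r))
    (hadd : (G.rmdo m br r).pop.add (br r (G.rmdo m br r).las) = (G.rmdo m br r).pop) :
    (((G.rmdo m br r).len + 1 : ℕ) : ℝ) ≤ Δ ^ 2 * G.maxActs * X ^ 2 / ε ^ 2 := by
  by_contra! hlt
  refine hN ((G.rmdo m br r).isEpsNash_las hG hε hΔ
    (fun i => hbr r _ (State.las_isProfile _) i) hadd (le_trans ?_ hlt.le))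
  have : ((G.rmdo m br r).game.size : ℝ) ≤ X := by exact_mod_cast hX
  gcongr

/-- There are finitely many windows, and none of them is infinite. -/
theorem exists_computesBR_isEpsNash (G : EFG A I) (hG : G.PerfectRecall) {m : ℕ → ℕ}
    {br : ℕ → Profile A I → G.PureProfile} (hm : ∀ j, 0 < m j) (hbr : G.IsOracle br) {Δ ε : ℝ}
    (hε : 0 < ε) (hΔ : ∀ z ∈ G.terminals, ∀ w ∈ G.terminals, G.payoff z - G.payoff w ≤ Δ) :
    ∃ t, 1 ≤ t ∧ G.ComputesBR m br t ∧ G.IsEpsNash ε (G.las m br t) := by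
  by_contra! hc
  set D : ℝ := Δ ^ 2 * G.maxActs * G.size ^ 2 / ε ^ 2 with hD
  have hD0 : 0 ≤ D := by positivity
  set K := ∑ i, ∑ s ∈ G.infosets i, (G.avail i s).card with hK
  obtain ⟨T, hTlt⟩ := exists_nat_gt (∑ j ∈ range (K + 1), (D + m j))
  have hT : 1 ≤ T := by
    have h0 : (0 : ℝ) ≤ ∑ j ∈ range (K + 1), (D + m j) :=
      Finset.sum_nonneg fun j _ => by positivity
    exact_mod_cast h0.trans_lt hTlt
  have h1 := (G.iterations_and_numBR_le br hm hD0 hT fun r hr _ hB hadd =>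
    G.len_le_of_add_eq hG hbr hε hΔ (G.size_restrict_le _) (hc r hr hB) hadd).1
  have h2 : ∑ j ∈ range (G.numWindows m br T), (D + m j) ≤ ∑ j ∈ range (K + 1), (D + m j) :=
    Finset.sum_le_sum_of_subset_of_nonneg
      (range_mono (Nat.succ_le_succ (G.win_rmdo_le m br hT))) fun j _ _ => by positivity
  linarith

/-- The bound holds as long as no earlier computation of best responses has been made to an
`ε`-equilibrium. -/
theorem samples_le_rmdoBound (G : EFG A I) (hG : G.PerfectRecall) {m : ℕ → ℕ}
    {br : ℕ → Profile A I → G.PureProfile} (hm : ∀ j, 0 < m j) (hbr : G.IsOracle br) {Δ ε : ℝ}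
    (hε : 0 < ε) (hΔ : ∀ z ∈ G.terminals, ∀ w ∈ G.terminals, G.payoff z - G.payoff w ≤ Δ)
    {T : ℕ} (hT : 1 ≤ T)
    (hbad : ∀ r, 1 ≤ r → r < T → G.ComputesBR m br r → ¬ G.IsEpsNash ε (G.las m br r)) :
    (G.samples m br T : ℝ) ≤
      4 * rmdoBound m Δ ε (G.numWindows m br T) G.maxActs (G.windowSize m br T) := by
  set X := G.windowSize m br T with hX
  set D : ℝ := Δ ^ 2 * G.maxActs * X ^ 2 / ε ^ 2 with hD
  have hD0 : 0 ≤ D := by positivity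
  obtain ⟨h1, h2⟩ := G.iterations_and_numBR_le br hm hD0 hT fun r hr hrT hB hadd =>
    G.len_le_of_add_eq hG hbr hε hΔ (G.windowSize_mono m br hr hrT.le) (hbad r hr hrT hB) hadd
  have h3 : (G.samples m br T : ℝ) ≤ X * (1 + T + G.numBR m br T) := by
    exact_mod_cast G.samples_le_windowSize_mul m br hT
  set k := G.numWindows m br T with hk
  have hm1 : ∀ j, (1 : ℝ) ≤ m j := fun j => by exact_mod_cast hm j
  have hone : (1 : ℝ) ≤ ∑ j ∈ range k, (m j : ℝ) :=
    (hm1 0).trans (Finset.single_le_sum (f := fun j => (m j : ℝ))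
      (fun j _ => by positivity) (mem_range.2 (Nat.succ_pos _)))
  have htwo : ∑ j ∈ range k, (D / m j + 2) ≤
      ∑ j ∈ range k, D / m j + 2 * ∑ j ∈ range k, (m j : ℝ) := by
    rw [Finset.mul_sum, ← Finset.sum_add_distrib]
    exact Finset.sum_le_sum fun j _ => by linarith [hm1 j]
  rw [Finset.sum_add_distrib, sum_const, card_range, nsmul_eq_mul] at h1
  have hbound : rmdoBound m Δ ε k G.maxActs X =
      X * (k * D + ∑ j ∈ range k, D / m j + ∑ j ∈ range k, (m j : ℝ)) := by
    rw [rmdoBound, Finset.sum_add_distrib, mul_add, mul_add, Finset.mul_sum, Finset.mul_sum, hD,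
      ← add_assoc]
    congr 2
    · ring
    · refine Finset.sum_congr rfl fun j _ => ?_
      have := (zero_lt_one.trans_le (hm1 j)).ne'
      field_simp
  have hkD : 0 ≤ k * D := by positivity
  have hDm : 0 ≤ ∑ j ∈ range k, D / m j := Finset.sum_nonneg fun j _ => by positivity
  rw [hbound]
  calc (G.samples m br T : ℝ) ≤ X * (1 + T + G.numBR m br T) := h3
    _ ≤ X * (4 * (k * D + ∑ j ∈ range k, D / m j + ∑ j ∈ range k, (m j : ℝ))) := by
        gcongr
        linarith
    _ = _ := by ring

end EFG

theorem mainTheorem1 :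
    ∃ C : ℝ, 0 < C ∧
      ∀ (A : Type u) (I : Type v) (G : EFG A I) (m : ℕ → ℕ)
        (br : ℕ → Profile A I → G.PureProfile) (Δ ε : ℝ),
        G.PerfectRecall →
        (∀ z ∈ G.terminals, ∀ w ∈ G.terminals, G.payoff z - G.payoff w ≤ Δ) →
        (∀ j, 0 < m j) →
        G.IsOracle br →
        0 < ε →
        (∃ T : ℕ, IsLeast {t | 1 ≤ t ∧ G.IsEpsNash ε (G.las m br t)} T ∧
          (G.samples m br T : ℝ) ≤
            C * EFG.rmdoBound m Δ ε (G.numWindows m br T) G.maxActs (G.windowSize m br T)) ∧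
        (∃ T : ℕ, IsLeast {t | 1 ≤ t ∧ G.ComputesBR m br t ∧ G.IsEpsNash ε (G.las m br t)} T ∧
          (G.samples m br T : ℝ) ≤
            C * EFG.rmdoBound m Δ ε (G.numWindows m br T) G.maxActs (G.windowSize m br T)) := by
  refine ⟨4, by norm_num, fun A I G m br Δ ε hG hΔ hm hbr hε => ?_⟩
  have hex := G.exists_computesBR_isEpsNash hG hm hbr hε hΔ
  have hex' : ∃ t, 1 ≤ t ∧ G.IsEpsNash ε (G.las m br t) :=
    hex.imp fun t ht => ⟨ht.1, ht.2.2⟩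
  refine ⟨⟨Nat.find hex', ⟨Nat.find_spec hex', fun t ht => Nat.find_min' hex' ht⟩, ?_⟩,
    ⟨Nat.find hex, ⟨Nat.find_spec hex, fun t ht => Nat.find_min' hex ht⟩, ?_⟩⟩
  · exact G.samples_le_rmdoBound hG hm hbr hε hΔ (Nat.find_spec hex').1
      fun r hr hlt _ hN => Nat.find_min hex' hlt ⟨hr, hN⟩
  · exact G.samples_le_rmdoBound hG hm hbr hε hΔ (Nat.find_spec hex).1
      fun r hr hlt hB hN => Nat.find_min hex hlt ⟨hr, hB, hN⟩
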